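/- Conventions. Locally compact groups are Hausdorff. For a topological group $G$, a continuous discrete $G$-set is a set $X$ with the discrete topology and a continuous action of $G$ (i.e. point stabilizers are open); $\ell^2(X)$ is the real Hilbert space of square-summable functions on $X$ with the orthogonal representation $(gf)(x)=f(g^{-1}x)$. Orthogonal representations are on real Hilbert spaces and continuous means strongly continuous. For a continuous orthogonal representation $(u,\mathcal H)$ of $G$, let $Z^1(G,u)$ be the space of continuous maps $b:G\to\mathcal H$ with $b(gh)=u(g)b(h)+b(g)$, with the topology of uniform convergence on compact subsets, and let $B^1(G,u)$ be the subspace of maps $g\mapsto\xi-u(g)\xi$ ($\xi\in\mathcal H$); put $H^1(G,u)=Z^1(G,u)/B^1(G,u)$ and $\overline{H^1}(G,u)=Z^1(G,u)/\overline{B^1(G,u)}$. Write $\mathbf 1_G\prec u$ if for every compact $K\subset G$ and $\varepsilon>0$ there is $\xi\in\mathcal H$ with $\|\xi\|=1$ and $\|\xi-u(g)\xi\|\le\varepsilon$ for all $g\in K$. Let $\pi:H\to Q$ be a continuous homomorphism with dense image between locally compact groups. For a continuous orthogonal representation $(u,\mathcal H)$ of $H$, let $\mathcal H^Q$ be the closed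 subspace of those $x\in\mathcal H$ such that $\inf_V\sup_{g\in V}\|x-u(g)x\|=0$, where $V$ ranges over the subsets of $H$ containing $\pi^{-1}(W)$ for some neighbourhood $W$ of $1$ in $Q$; let $u^Q$ be the unique continuous orthogonal representation of $Q$ on $\mathcal H^Q$ such that $u^Q(\pi(h))x=u(h)x$ for all $h\in H$, $x\in\mathcal H^Q$. The homomorphism $\pi$ is called a Kazhdan homomorphism if for every continuous orthogonal representation $u$ of $H$, $\mathbf 1_H\prec u$ implies $\mathbf 1_Q\prec u^Q$. A continuous discrete $G$-set $X$ is Eymard-amenable if there is a $G$-invariant mean on $X$ (a positive normalized $G$-invariant linear functional on the bounded real functions on $X$). The group $G$ has - Property dFH if $H^1(G,\ell^2(X))=0$ for every continuous discrete $G$-set $X$; - Property $\overline{\mathrm{dFH}}$ if $\overline{H^1}(G,\ell^2(X))=0$ for every continuous discrete $G$-set $X$; - Property FM if every Eymard-amenable continuous discrete $G$-set has a finite orbit; - Property FM' if every transitive Eymard-amenable continuous discrete $G$-set is finite. Theorem. Let $\pi:H\to Q$ be a continuous homomorphism with dense image between locally compact groups, and suppose that $\pi$ is a Kazhdan homomorphism.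 Let (P) be one of the properties dFH, $\overline{\mathrm{dFH}}$, FM, FM'. Then $H$ has Property (P) if and only if $Q$ has Property (P). -/

import Mathlib

open Filter Topology BoundedContinuousFunction
open scoped ENNReal

universe u v w

/-- A (strongly) continuous orthogonal representation of a topological group `G` on a real
inner product space `E`. -/
structure OrthRep (G : Type u) [Group G] [TopologicalSpace G]
    (E : Type v) [NormedAddCommGroup E] [InnerProductSpace ℝ E] where
  /-- the underlying homomorphism to the orthogonal group of `E` -/
  toHom : G →* (E ≃ₗᵢ[ℝ] E)
  /-- orbit maps are continuous -/
  continuous_orbit : ∀ x : E, Continuous fun g : G => toHom g x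

namespace OrthRep

section Basic

variable {G : Type u} [Group G] [TopologicalSpace G]
  {E : Type v} [NormedAddCommGroup E] [InnerProductSpace ℝ E]

theorem toHom_mul_apply (ρ : OrthRep G E) (g h : G) (x : E) :
    ρ.toHom (g * h) x = ρ.toHom g (ρ.toHom h x) := by
  rw [map_mul]
  rfl

/-- `1_G ≺ ρ`: the representation almost has invariant vectors. -/
def AlmostHasInvariantVectors (ρ : OrthRep G E) : Prop :=
  ∀ K : Set G, IsCompact K → ∀ ε : ℝ, 0 < ε →
    ∃ ξ : E, ‖ξ‖ = 1 ∧ ∀ g ∈ K, ‖ξ - ρ.toHom g ξ‖ ≤ ε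

/-- The space `Z¹(G, ρ)` of continuous 1-cocycles. It carries the topology of uniform convergence
on compact subsets, induced from the compact-open topology of `C(G, E)`. -/
def Z1 (ρ : OrthRep G E) : Submodule ℝ C(G, E) where
  carrier := {b | ∀ g h : G, b (g * h) = ρ.toHom g (b h) + b g}
  add_mem' := by
    intro b c hb hc g h
    simp only [ContinuousMap.add_apply, hb g h, hc g h, map_add]
    abel
  zero_mem' := by
    intro g h
    simp
  smul_mem' := by
    intro r b hb g h
    simp only [ContinuousMap.smul_apply, hb g h, map_smul, smul_add]

/-- The linear map sending a vector `ξ` to the 1-coboundary `g ↦ ξ - ρ(g) ξ`. -/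
def coboundary (ρ : OrthRep G E) : E →ₗ[ℝ] ρ.Z1 where
  toFun ξ := ⟨⟨fun g => ξ - ρ.toHom g ξ, continuous_const.sub (ρ.continuous_orbit ξ)⟩, by
    intro g h
    simp only [ContinuousMap.coe_mk, map_mul, LinearIsometryEquiv.coe_mul, Function.comp_apply, map_sub]
    abel⟩
  map_add' ξ η := by
    ext g
    simp only [ContinuousMap.coe_mk, Submodule.coe_add, ContinuousMap.add_apply, map_add]
    abel
  map_smul' r ξ := by
    ext g
    simp [smul_sub]

/-- The space `B¹(G, ρ)` of 1-coboundaries, as a subspace of `Z¹(G, ρ)`. -/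
def B1 (ρ : OrthRep G E) : Submodule ℝ ρ.Z1 := LinearMap.range ρ.coboundary

/-- First cohomology `H¹(G, ρ) = Z¹(G, ρ) / B¹(G, ρ)`. -/
abbrev H1 (ρ : OrthRep G E) : Type (max u v) := ρ.Z1 ⧸ ρ.B1

/-- Reduced first cohomology: the quotient of `Z¹(G, ρ)` by the closure of `B¹(G, ρ)` for uniform
convergence on compact subsets. -/
abbrev ReducedH1 (ρ : OrthRep G E) : Type (max u v) := ρ.Z1 ⧸ ρ.B1.topologicalClosure

end Basic

section QPoints

variable {H : Type u} [Group H] [TopologicalSpace H]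
  {Q : Type w} [Group Q] [TopologicalSpace Q]
  {E : Type v} [NormedAddCommGroup E] [InnerProductSpace ℝ E]

/-- The set of `Q`-points: `x` such that `inf_V sup_{g ∈ V} d(x, g x) = 0`, where `V` ranges over
the subsets of `H` containing `π⁻¹(W)` for some neighbourhood `W` of `1` in `Q`. -/
def qPointsSet (ρ : OrthRep H E) (π : H →* Q) : Set E :=
  {x | ⨅ V ∈ comap π (𝓝 (1 : Q)), ⨆ g ∈ V, edist x (ρ.toHom g x) = 0}

theorem mem_qPointsSet (ρ : OrthRep H E) (π : H →* Q) (x : E) :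
    x ∈ ρ.qPointsSet π ↔
      ∀ ε : ℝ, 0 < ε → ∀ᶠ q in 𝓝 (1 : Q), ∀ h : H, π h = q → dist x (ρ.toHom h x) ≤ ε := by
  unfold qPointsSet
  rw [Set.mem_ofPred_eq, ← nonpos_iff_eq_zero]
  constructor
  · intro hx ε hε
    have h1 : (⨅ V ∈ comap π (𝓝 (1 : Q)), ⨆ g ∈ V, edist x (ρ.toHom g x)) < ENNReal.ofReal ε :=
      lt_of_le_of_lt hx (by simpa using hε)
    simp only [iInf_lt_iff] at h1
    obtain ⟨V, hV, h2⟩ := h1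
    rw [← eventually_comap]
    filter_upwards [hV] with g hg
    have h3 : edist x (ρ.toHom g x) ≤ ENNReal.ofReal ε :=
      le_trans (le_iSup₂ (f := fun g (_ : g ∈ V) => edist x (ρ.toHom g x)) g hg) h2.le
    rwa [edist_dist, ENNReal.ofReal_le_ofReal_iff hε.le] at h3
  · intro hx
    refine le_of_forall_gt fun c hc => ?_
    obtain ⟨ε, hε, hεc⟩ : ∃ ε : ℝ, 0 < ε ∧ ENNReal.ofReal ε < c := by
      obtain ⟨r, hr0, hrc⟩ := ENNReal.lt_iff_exists_nnreal_btwn.1 hc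
      exact ⟨r, by exact_mod_cast hr0, by simpa using hrc⟩
    have h1 := hx ε hε
    rw [← eventually_comap] at h1
    refine lt_of_le_of_lt (iInf₂_le {g | dist x (ρ.toHom g x) ≤ ε} h1) (lt_of_le_of_lt (iSup₂_le fun g hg => ?_) hεc)
    rw [edist_dist]
    exact ENNReal.ofReal_le_ofReal hg

/-- The closed linear subspace `E^Q` of `Q`-points (for a linear isometric action). -/
def qPoints [IsTopologicalGroup Q] (ρ : OrthRep H E) (π : H →* Q) : Submodule ℝ E where
  carrier := ρ.qPointsSet π
  zero_mem' := by
    rw [mem_qPointsSet]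
    intro ε hε
    exact Eventually.of_forall fun q h _ => by simpa using hε.le
  add_mem' := by
    intro x y hx hy
    rw [mem_qPointsSet] at hx hy ⊢
    intro ε hε
    filter_upwards [hx (ε / 2) (by positivity), hy (ε / 2) (by positivity)] with q h1 h2 h hq
    rw [map_add]
    exact (dist_add_add_le _ _ _ _).trans (by linarith [h1 h hq, h2 h hq])
  smul_mem' := by
    intro r x hx
    rw [mem_qPointsSet] at hx ⊢
    intro ε hε
    filter_upwards [hx (ε / (|r| + 1)) (by positivity)] with q h1 h hq
    rw [map_smul, dist_smul₀, Real.norm_eq_abs]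
    have h2 := h1 h hq
    rw [le_div_iff₀ (by positivity)] at h2
    nlinarith [dist_nonneg (x := x) (y := ρ.toHom h x), abs_nonneg r]

theorem mem_qPoints [IsTopologicalGroup Q] (ρ : OrthRep H E) (π : H →* Q) (x : E) :
    x ∈ ρ.qPoints π ↔
      ∀ ε : ℝ, 0 < ε → ∀ᶠ q in 𝓝 (1 : Q), ∀ h : H, π h = q → dist x (ρ.toHom h x) ≤ ε :=
  mem_qPointsSet ρ π x

variable [IsTopologicalGroup Q]

theorem isClosed_qPoints (ρ : OrthRep H E) (π : H →* Q) : IsClosed (ρ.qPoints π : Set E) := by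
  refine isClosed_of_closure_subset fun x hx => ?_
  rw [SetLike.mem_coe, mem_qPoints]
  intro ε hε
  obtain ⟨y, hy, hxy⟩ := Metric.mem_closure_iff.1 hx (ε / 3) (by positivity)
  rw [SetLike.mem_coe, mem_qPoints] at hy
  filter_upwards [hy (ε / 3) (by positivity)] with q h1 h hq
  have h2 : dist (ρ.toHom h y) (ρ.toHom h x) = dist x y := by
    rw [LinearIsometryEquiv.dist_map, dist_comm]
  have h3 := dist_triangle4 x y (ρ.toHom h y) (ρ.toHom h x)
  linarith [h1 h hq]

theorem map_mem_qPoints (ρ : OrthRep H E) (π : H →* Q) (h₀ : H) {x : E}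
    (hx : x ∈ ρ.qPoints π) : ρ.toHom h₀ x ∈ ρ.qPoints π := by
  rw [mem_qPoints] at hx ⊢
  intro ε hε
  have hc : Tendsto (fun q : Q => (π h₀)⁻¹ * q * π h₀) (𝓝 1) (𝓝 1) := by
    have : Continuous fun q : Q => (π h₀)⁻¹ * q * π h₀ := by fun_prop
    simpa using this.tendsto 1
  filter_upwards [hc.eventually (hx ε hε)] with q h1 h hq
  have h2 := h1 (h₀⁻¹ * h * h₀) (by simp [hq])
  have h3 : ρ.toHom h (ρ.toHom h₀ x) = ρ.toHom h₀ (ρ.toHom (h₀⁻¹ * h * h₀) x) := by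
    rw [← toHom_mul_apply, ← toHom_mul_apply]
    congr 2
    group
  rwa [h3, LinearIsometryEquiv.dist_map]

theorem comap_neBot {H : Type u} [Group H] {Q : Type w} [Group Q] [TopologicalSpace Q] {π : H →* Q} (hπ : DenseRange π) (q : Q) : (comap π (𝓝 q)).NeBot := by
  rw [comap_neBot_iff]
  intro t ht
  obtain ⟨y, hy, h, rfl⟩ := mem_closure_iff_nhds.1 (hπ q) t ht
  exact ⟨h, hy⟩

theorem dist_orbit (ρ : OrthRep H E) (h h' : H) (x : E) :
    dist (ρ.toHom h x) (ρ.toHom h' x) = dist x (ρ.toHom (h⁻¹ * h') x) := by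
  have : ρ.toHom h' x = ρ.toHom h (ρ.toHom (h⁻¹ * h') x) := by
    rw [← toHom_mul_apply]
    simp
  rw [this, LinearIsometryEquiv.dist_map]

theorem exists_tendsto_orbit [CompleteSpace E] (ρ : OrthRep H E) {π : H →* Q}
    (hπ : DenseRange π) (q : Q) {x : E} (hx : x ∈ ρ.qPoints π) :
    ∃ y : E, Tendsto (fun h => ρ.toHom h x) (comap π (𝓝 q)) (𝓝 y) := by
  have := comap_neBot hπ q
  refine CompleteSpace.complete (f := map (fun h => ρ.toHom h x) (comap π (𝓝 q))) ?_
  rw [Metric.cauchy_iff]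
  refine ⟨inferInstance, fun ε hε => ?_⟩
  rw [mem_qPoints] at hx
  have hc : Tendsto (fun p : Q × Q => p.1⁻¹ * p.2) (𝓝 q ×ˢ 𝓝 q) (𝓝 1) := by
    have : Continuous fun p : Q × Q => p.1⁻¹ * p.2 := by fun_prop
    have h := this.tendsto (q, q)
    rwa [nhds_prod_eq, inv_mul_cancel] at h
  have h1 := hc.eventually (hx (ε / 2) (by positivity))
  obtain ⟨t, ht, h2⟩ := (eventually_prod_self_iff
    (r := fun a b : Q => ∀ h : H, π h = a⁻¹ * b → dist x (ρ.toHom h x) ≤ ε / 2)).1 h1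
  refine ⟨(fun h => ρ.toHom h x) '' (π ⁻¹' t), image_mem_map (preimage_mem_comap ht), ?_⟩
  rintro _ ⟨h, hh, rfl⟩ _ ⟨h', hh', rfl⟩
  dsimp only
  rw [dist_orbit]
  have := h2 _ hh _ hh' (h⁻¹ * h') (by simp)
  linarith

/-- For `q ∈ Q` and a `Q`-point `x`, the vector `q x = lim_{π(h) → q} h x`. -/
noncomputable def qAct [CompleteSpace E] (ρ : OrthRep H E) {π : H →* Q}
    (hπ : DenseRange π) (q : Q) (x : ρ.qPoints π) : E :=
  Classical.choose (ρ.exists_tendsto_orbit hπ q x.2)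

variable [CompleteSpace E]

theorem tendsto_qAct (ρ : OrthRep H E) {π : H →* Q} (hπ : DenseRange π) (q : Q)
    (x : ρ.qPoints π) :
    Tendsto (fun h => ρ.toHom h x) (comap π (𝓝 q)) (𝓝 (ρ.qAct hπ q x)) :=
  Classical.choose_spec (ρ.exists_tendsto_orbit hπ q x.2)

theorem qAct_mem (ρ : OrthRep H E) {π : H →* Q} (hπ : DenseRange π) (q : Q)
    (x : ρ.qPoints π) : ρ.qAct hπ q x ∈ ρ.qPoints π := by
  have := comap_neBot hπ q
  exact (ρ.isClosed_qPoints π).mem_of_tendsto (ρ.tendsto_qAct hπ q x)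
    (Eventually.of_forall fun h => ρ.map_mem_qPoints π h x.2)

theorem qAct_apply (ρ : OrthRep H E) {π : H →* Q} (hπ : DenseRange π) (h : H)
    (x : ρ.qPoints π) : ρ.qAct hπ (π h) x = ρ.toHom h x := by
  have := comap_neBot hπ (π h)
  refine tendsto_nhds_unique (ρ.tendsto_qAct hπ (π h) x) ?_
  rw [Metric.tendsto_nhds]
  intro ε hε
  have hx := (ρ.mem_qPoints π x).1 x.2 (ε / 2) (by positivity)
  have hc : Tendsto (fun q : Q => (π h)⁻¹ * q) (𝓝 (π h)) (𝓝 1) := by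
    have : Continuous fun q : Q => (π h)⁻¹ * q := by fun_prop
    simpa using this.tendsto (π h)
  filter_upwards [preimage_mem_comap (hc.eventually hx)] with h' hh'
  rw [dist_comm, dist_orbit]
  have := hh' (h⁻¹ * h') (by simp)
  linarith

theorem continuous_qAct (ρ : OrthRep H E) {π : H →* Q} (hπ : DenseRange π)
    (x : ρ.qPoints π) : Continuous fun q => ρ.qAct hπ q x := by
  rw [continuous_iff_continuousAt]
  intro q
  rw [ContinuousAt, Metric.tendsto_nhds]
  intro ε hε
  have := comap_neBot hπ q
  have h1 : ∀ᶠ h in comap π (𝓝 q), dist (ρ.toHom h x) (ρ.qAct hπ q x) ≤ ε / 2 :=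
    ((Metric.tendsto_nhds.1 (ρ.tendsto_qAct hπ q x)) (ε / 2) (by positivity)).mono
      fun _ h => h.le
  rw [eventually_comap] at h1
  filter_upwards [eventually_eventually_nhds.2 h1] with q' h2
  have := comap_neBot hπ q'
  have h3 : ∀ᶠ h in comap π (𝓝 q'), dist (ρ.toHom h x) (ρ.qAct hπ q x) ≤ ε / 2 := by
    rw [eventually_comap]
    exact h2
  have h4 := le_of_tendsto ((ρ.tendsto_qAct hπ q' x).dist tendsto_const_nhds) h3
  linarith

theorem norm_qAct (ρ : OrthRep H E) {π : H →* Q} (hπ : DenseRange π) (q : Q)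
    (x : ρ.qPoints π) : ‖ρ.qAct hπ q x‖ = ‖x‖ := by
  have := comap_neBot hπ q
  refine tendsto_nhds_unique (ρ.tendsto_qAct hπ q x).norm ?_
  simp

theorem qAct_mul (ρ : OrthRep H E) {π : H →* Q} (hπ : DenseRange π) (p q : Q)
    (x : ρ.qPoints π) :
    ρ.qAct hπ (p * q) x = ρ.qAct hπ p ⟨ρ.qAct hπ q x, ρ.qAct_mem hπ q x⟩ := by
  have h1 : ∀ (h : H) (q : Q), ρ.qAct hπ (π h * q) x = ρ.toHom h (ρ.qAct hπ q x) := by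
    intro h
    refine congrFun (hπ.equalizer ((ρ.continuous_qAct hπ x).comp (continuous_const_mul (π h)))
      ((ρ.toHom h).continuous.comp (ρ.continuous_qAct hπ x)) ?_)
    funext h'
    simp only [Function.comp_apply]
    rw [← map_mul, qAct_apply, qAct_apply, map_mul, LinearIsometryEquiv.coe_mul, Function.comp_apply]
  refine congrFun (hπ.equalizer ((ρ.continuous_qAct hπ x).comp (continuous_mul_const q))
      (ρ.continuous_qAct hπ ⟨ρ.qAct hπ q x, ρ.qAct_mem hπ q x⟩) ?_) p
  funext h
  simp only [Function.comp_apply]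
  rw [h1, qAct_apply]

theorem qAct_one (ρ : OrthRep H E) {π : H →* Q} (hπ : DenseRange π)
    (x : ρ.qPoints π) : ρ.qAct hπ 1 x = x := by
  have := ρ.qAct_apply hπ 1 x
  simpa using this

/-- The linear isometry `x ↦ q x` of `E^Q`. -/
noncomputable def qIsometry (ρ : OrthRep H E) {π : H →* Q} (hπ : DenseRange π) (q : Q) :
    ρ.qPoints π →ₗᵢ[ℝ] ρ.qPoints π where
  toFun x := ⟨ρ.qAct hπ q x, ρ.qAct_mem hπ q x⟩
  map_add' x y := by
    have := comap_neBot hπ q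
    refine Subtype.ext (tendsto_nhds_unique (ρ.tendsto_qAct hπ q (x + y)) ?_)
    simpa using (ρ.tendsto_qAct hπ q x).add (ρ.tendsto_qAct hπ q y)
  map_smul' r x := by
    have := comap_neBot hπ q
    refine Subtype.ext (tendsto_nhds_unique (ρ.tendsto_qAct hπ q (r • x)) ?_)
    simpa using (ρ.tendsto_qAct hπ q x).const_smul r
  norm_map' x := ρ.norm_qAct hπ q x

/-- The continuous orthogonal representation `ρ^Q` of `Q` on `E^Q`: the unique one whose composition
with `π` is the restriction of `ρ` to `E^Q`. -/
noncomputable def qRep (ρ : OrthRep H E) (π : H →* Q) (hπ : DenseRange π) :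
    OrthRep Q (ρ.qPoints π) where
  toHom :=
    { toFun := fun q =>
        { (ρ.qIsometry hπ q).toLinearMap with
          invFun := ρ.qIsometry hπ q⁻¹
          left_inv := fun x => by
            refine Subtype.ext ?_
            change ρ.qAct hπ q⁻¹ ⟨ρ.qAct hπ q x, ρ.qAct_mem hπ q x⟩ = x
            rw [← qAct_mul, inv_mul_cancel, qAct_one]
          right_inv := fun x => by
            refine Subtype.ext ?_
            change ρ.qAct hπ q ⟨ρ.qAct hπ q⁻¹ x, ρ.qAct_mem hπ q⁻¹ x⟩ = x
            rw [← qAct_mul, mul_inv_cancel, qAct_one]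
          norm_map' := (ρ.qIsometry hπ q).norm_map }
      map_one' := by
        ext x
        exact ρ.qAct_one hπ x
      map_mul' := fun p q => by
        ext x
        exact ρ.qAct_mul hπ p q x }
  continuous_orbit x := (ρ.continuous_qAct hπ x).subtype_mk _

/-- The characterization of `ρ^Q`. -/
theorem qRep_apply (ρ : OrthRep H E) (π : H →* Q) (hπ : DenseRange π) (h : H)
    (x : ρ.qPoints π) : (((ρ.qRep π hπ).toHom (π h) x : ρ.qPoints π) : E) = ρ.toHom h x :=
  ρ.qAct_apply hπ h x

end QPoints

end OrthRep

/-- A homomorphism `π : H → Q` with dense image is a Kazhdan homomorphism if for every continuous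
orthogonal representation `ρ` of `H` on a real Hilbert space, `1_H ≺ ρ` implies `1_Q ≺ ρ^Q`. -/
def IsKazhdanHom {H Q : Type u} [Group H] [TopologicalSpace H]
    [Group Q] [TopologicalSpace Q] [IsTopologicalGroup Q]
    (π : H →* Q) (hπ : DenseRange π) : Prop :=
  ∀ (E : Type u) [NormedAddCommGroup E] [InnerProductSpace ℝ E] [CompleteSpace E]
    (ρ : OrthRep H E), ρ.AlmostHasInvariantVectors → (ρ.qRep π hπ).AlmostHasInvariantVectors

section L2

/-- The real Hilbert space `ℓ²(X)`. -/
abbrev EllTwo (X : Type v) : Type v := lp (fun _ : X => ℝ) 2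

variable {X : Type v}

/-- The isometry `f ↦ f ∘ σ⁻¹` of `ℓ²(X)` induced by a permutation `σ` of `X`. -/
noncomputable def ellTwoPerm (σ : Equiv.Perm X) : EllTwo X ≃ₗᵢ[ℝ] EllTwo X where
  toFun f := ⟨fun x => f (σ.symm x), by
    have := lp.memℓp f
    change Memℓp _ _
    rw [memℓp_gen_iff (by norm_num)] at this ⊢
    exact (σ.symm.summable_iff (f := fun i => ‖f i‖ ^ (2 : ℝ≥0∞).toReal)).2 this⟩
  invFun f := ⟨fun x => f (σ x), by
    have := lp.memℓp f
    change Memℓp _ _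
    rw [memℓp_gen_iff (by norm_num)] at this ⊢
    exact (σ.summable_iff (f := fun i => ‖f i‖ ^ (2 : ℝ≥0∞).toReal)).2 this⟩
  left_inv f := by
    ext x
    simp
  right_inv f := by
    ext x
    simp
  map_add' f g := by
    ext x
    rfl
  map_smul' r f := by
    ext x
    rfl
  norm_map' f := by
    rw [lp.norm_eq_tsum_rpow (by norm_num), lp.norm_eq_tsum_rpow (by norm_num)]
    congr 1
    exact σ.symm.tsum_eq (fun i => ‖f i‖ ^ (2 : ℝ≥0∞).toReal)

@[simp] theorem ellTwoPerm_apply (σ : Equiv.Perm X) (f : EllTwo X) (x : X) :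
    ellTwoPerm σ f x = f (σ.symm x) := rfl

end L2

section Perm

variable (G : Type u) [Group G] [TopologicalSpace G] (X : Type v)
  [TopologicalSpace X] [DiscreteTopology X] [MulAction G X] [ContinuousSMul G X]

/-- The permutation homomorphism `G → O(ℓ²(X))`, `(g f)(x) = f(g⁻¹ x)`. -/
noncomputable def ellTwoHom : G →* (EllTwo X ≃ₗᵢ[ℝ] EllTwo X) where
  toFun g := ellTwoPerm (MulAction.toPerm g)
  map_one' := by
    ext f x
    simp
  map_mul' g h := by
    ext f x
    simp [mul_smul]

theorem continuous_ellTwoHom_orbit (f : EllTwo X) :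
    Continuous fun g : G => ellTwoHom G X g f := by
  classical
  let S : Set (EllTwo X) := {f | Continuous fun g : G => ellTwoHom G X g f}
  have hclosed : IsClosed S := by
    refine isClosed_of_closure_subset fun f hf => ?_
    change Continuous _
    rw [continuous_iff_continuousAt]
    intro g₀
    rw [ContinuousAt, Metric.tendsto_nhds]
    intro ε hε
    obtain ⟨f', hf', hff'⟩ := Metric.mem_closure_iff.1 hf (ε / 3) (by positivity)
    have h1 := Metric.tendsto_nhds.1 ((show Continuous _ from hf').tendsto g₀) (ε / 3)
      (by positivity)
    filter_upwards [h1] with g hg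
    have h2 := dist_triangle4 (ellTwoHom G X g f) (ellTwoHom G X g f') (ellTwoHom G X g₀ f')
      (ellTwoHom G X g₀ f)
    rw [LinearIsometryEquiv.dist_map, LinearIsometryEquiv.dist_map, dist_comm f' f] at h2
    linarith
  have hsingle : ∀ (x : X) (a : ℝ), lp.single 2 x a ∈ S := by
    intro x a
    have h1 : (fun g : G => ellTwoHom G X g (lp.single 2 x a)) =
        (fun y : X => (lp.single 2 y a : EllTwo X)) ∘ fun g : G => g • x := by
      funext g
      ext y
      change (lp.single 2 x a : EllTwo X) (g⁻¹ • y) = (lp.single 2 (g • x) a : EllTwo X) y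
      rw [lp.single_apply, lp.single_apply]
      by_cases hxy : y = g • x
      · subst hxy
        simp
      · have : g⁻¹ • y ≠ x := fun h => hxy (by rw [← h, smul_inv_smul])
        simp [hxy, this]
    change Continuous _
    rw [h1]
    exact continuous_of_discreteTopology.comp (continuous_id.smul continuous_const)
  have hsum : ∀ s : Finset X, ∑ x ∈ s, lp.single 2 x (f x) ∈ S := by
    intro s
    change Continuous _
    simp only [map_sum]
    exact continuous_finsetSum _ fun x _ => hsingle x (f x)
  exact hclosed.mem_of_tendsto (lp.hasSum_single (by norm_num) f) (Eventually.of_forall hsum)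

/-- The representation of `G` on `ℓ²(X)`, for a continuous discrete `G`-set `X`. -/
noncomputable def ellTwoRep : OrthRep G (EllTwo X) where
  toHom := ellTwoHom G X
  continuous_orbit := continuous_ellTwoHom_orbit G X

/-- The continuous discrete `G`-set `X` is Eymard-amenable: there is a `G`-invariant mean on `X`,
that is, an invariant positive normalized linear functional on bounded real functions on `X`. -/
def EymardAmenable : Prop :=
  ∃ m : (X →ᵇ ℝ) →ₗ[ℝ] ℝ, (∀ f : X →ᵇ ℝ, 0 ≤ f → 0 ≤ m f) ∧ m 1 = 1 ∧
    ∀ (g : G) (f : X →ᵇ ℝ),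
      m (f.compContinuous ⟨fun x : X => g • x, continuous_of_discreteTopology⟩) = m f

end Perm

section Properties

variable (G : Type u) [Group G] [TopologicalSpace G]

/-- Property dFH: `H¹(G, ℓ²(X)) = 0` for every continuous discrete `G`-set `X`. -/
def PropertyDFH : Prop :=
  ∀ (X : Type u) [TopologicalSpace X] [DiscreteTopology X] [MulAction G X] [ContinuousSMul G X],
    Subsingleton (ellTwoRep G X).H1

/-- Reduced Property dFH: the reduced first cohomology of `G` in `ℓ²(X)` vanishes for every
continuous discrete `G`-set `X`. -/
def PropertyReducedDFH : Prop :=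
  ∀ (X : Type u) [TopologicalSpace X] [DiscreteTopology X] [MulAction G X] [ContinuousSMul G X],
    Subsingleton (ellTwoRep G X).ReducedH1

/-- Property FM: every Eymard-amenable continuous discrete `G`-set has a finite orbit. -/
def PropertyFM : Prop :=
  ∀ (X : Type u) [TopologicalSpace X] [DiscreteTopology X] [MulAction G X] [ContinuousSMul G X],
    EymardAmenable G X → ∃ x : X, (MulAction.orbit G x).Finite

/-- Property FM': every transitive Eymard-amenable continuous discrete `G`-set is finite. -/
def PropertyFM' : Prop :=
  ∀ (X : Type u) [TopologicalSpace X] [DiscreteTopology X] [MulAction G X] [ContinuousSMul G X]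
    [MulAction.IsPretransitive G X], EymardAmenable G X → Finite X

end Properties

/-!
The four properties pass between `H` and `Q` along a Kazhdan homomorphism `π`.

**The basic consequence of the Kazhdan property.** Let `(φ i)` be a family of continuous normalized
nonnegative functions of positive type on `H` that approximates `1` uniformly on compact sets. The
direct sum of the associated representations almost has invariant vectors, so it has a nonzero
`Q`-point, and therefore some `φ i` stays away from `0` on `π⁻¹(W)`, for a neighbourhood `W` of `1` in
`Q`, up to finitely many translations (`IsKazhdanHom.exists_le_of_approx_one`).

**Cocycles of `H`.** Applied to the functions `exp (-‖b‖² / n)`, this shows that a cocycle `b` of `H` is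
bounded on some `π⁻¹(W)`. A circumcentre argument then changes `b` by a coboundary so that it tends to
`0` as `W` shrinks to `1`, and such a cocycle extends to a cocycle of `Q` with values in the `Q`-points
(`IsKazhdanHom.exists_qRep_cocycle`).

**`Q`-points of `ℓ²(X)`.** Level sets of `Q`-points of `ℓ²(X)` are finite and invariant under some
`π⁻¹(W)`. The minimal nonempty sets of this kind, the atoms, form a discrete `Q`-set `Y`, and the space of
`Q`-points is `ℓ²(Y)` (`exists_qPoints_equiv_ellTwo`). With the previous paragraph this gives dFH and
its reduced version for `H` when they hold for `Q`.

**Means.** If `X` has an `H`-invariant mean, then `ℓ²(X)` almost has invariant vectors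
(`EymardAmenable.almostHasInvariantVectors`). The point is uniformity on compact sets. There is an open
subgroup `U` whose image modulo the kernel of the action is compact; it has finite orbits and is
commensurable with its conjugates, so an invariant mean may be averaged over `U`-orbits, and the
Hahn–Banach theorem yields `U`-invariant almost invariant densities. By the Kazhdan property `ℓ²(Y)`
almost has invariant vectors, so `Y` has an invariant mean. As atoms are finite, finiteness of an orbit
in `Y` gives finiteness of an orbit in `X`.

**From `H` to `Q`.** A `Q`-set is an `H`-set through `π`, and density of the image suffices for dFH, FM
and FM'. For reduced dFH, let `b` be a cocycle of `Q` that is a limit of coboundaries on compact subsets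
of `H`. The basic consequence, applied to `exp (-∑ 2ⁿ ‖b - ∂ξₙ‖²)` and to indicator functions of compactly
generated open subgroups, together with the Baire category theorem, makes it a limit of coboundaries
uniformly on compact subsets of `Q` (`IsKazhdanHom.exists_coboundary_of_comp`).
-/

/-! ### Positive semidefinite kernels -/

section Kernels

open Matrix

variable {Y : Type*}

theorem posSemidef_of_tendsto {k : ℕ → Matrix Y Y ℝ} {K : Matrix Y Y ℝ}
    (hk : ∀ n, (k n).PosSemidef) (hlim : ∀ x y, Tendsto (fun n => k n x y) atTop (𝓝 (K x y))) :
    K.PosSemidef := by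
  refine ⟨?_, fun f => ?_⟩
  · ext x y
    refine tendsto_nhds_unique (hlim y x) ((hlim x y).congr fun n => ?_)
    simpa using ((hk n).1.apply x y).symm
  · refine ge_of_tendsto' (x := atTop)
      (f := fun n => f.sum fun i xi => f.sum fun j xj => star xi * k n i j * xj) ?_ fun n => (hk n).2 f
    exact tendsto_finsetSum _ fun i _ => tendsto_finsetSum _ fun j _ =>
      ((hlim i j).const_mul _).mul_const _

theorem posSemidef_mul {A B : Matrix Y Y ℝ} (hA : A.PosSemidef) (hB : B.PosSemidef) :
    (Matrix.of fun x y => A x y * B x y).PosSemidef :=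
  hA.hadamard hB

theorem posSemidef_inner {E : Type*} [NormedAddCommGroup E] [InnerProductSpace ℝ E] (p : Y → E) :
    (Matrix.of fun x y => inner ℝ (p x) (p y)).PosSemidef := by
  refine ⟨?_, fun f => ?_⟩
  · ext x y
    simp [real_inner_comm]
  · refine (real_inner_self_nonneg (x := f.sum fun i a => a • p i)).trans_eq ?_
    simp only [Finsupp.sum, sum_inner, inner_sum, inner_smul_left, inner_smul_right, conj_trivial,
      Matrix.of_apply, star_trivial]
    refine Finset.sum_congr rfl fun x _ => ?_
    rw [Finset.mul_sum]
    refine Finset.sum_congr rfl fun y _ => ?_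
    rw [real_inner_comm]
    ring

theorem posSemidef_const_one : (Matrix.of fun _ _ : Y => (1 : ℝ)).PosSemidef := by
  simpa using posSemidef_inner (fun _ : Y => (1 : ℝ))

theorem posSemidef_exp {k : Matrix Y Y ℝ} (hk : k.PosSemidef) :
    (Matrix.of fun x y => Real.exp (k x y)).PosSemidef := by
  have hpow : ∀ n : ℕ, (Matrix.of fun x y => k x y ^ n).PosSemidef := by
    intro n
    induction n with
    | zero => simpa using posSemidef_const_one (Y := Y)
    | succ n ih =>
      simpa [pow_succ] using posSemidef_mul ih hk
  refine posSemidef_of_tendsto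
    (k := fun N => ∑ n ∈ Finset.range N, (1 / (n.factorial : ℝ)) • Matrix.of fun x y => k x y ^ n)
    (fun N => ?_) fun x y => ?_
  · induction N with
    | zero => simpa using Matrix.PosSemidef.zero
    | succ N ih =>
      rw [Finset.sum_range_succ]
      exact ih.add ((hpow N).smul (by positivity))
  · have h := (NormedSpace.expSeries_div_hasSum_exp (𝔸 := ℝ) (k x y)).tendsto_sum_nat
    rw [← Real.exp_eq_exp_ℝ] at h
    refine h.congr fun N => ?_
    simp [Matrix.sum_apply, div_eq_inv_mul]

/-- The Gaussian kernel is positive semidefinite: up to the rank one factor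
`exp (-w ‖p x‖²) exp (-w ‖p y‖²)` it is the exponential of `2 w` times a Gram matrix. -/
theorem posSemidef_gaussian {E : Type*} [NormedAddCommGroup E] [InnerProductSpace ℝ E]
    (p : Y → E) {w : ℝ} (hw : 0 ≤ w) :
    (Matrix.of fun x y => Real.exp (-(w * ‖p x - p y‖ ^ 2))).PosSemidef := by
  have h1 := posSemidef_exp ((posSemidef_inner p).smul (show 0 ≤ 2 * w by positivity))
  have h2 := posSemidef_inner (fun x : Y => Real.exp (-(w * ‖p x‖ ^ 2)))
  refine (congrArg Matrix.PosSemidef ?_).mp (posSemidef_mul h2 h1)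
  ext x y
  simp only [of_apply, Matrix.smul_apply, smul_eq_mul, RCLike.inner_apply, conj_trivial,
    ← Real.exp_add, norm_sub_sq_real]
  congr 1
  ring

theorem posSemidef_exp_neg_sum {E : Type*} [NormedAddCommGroup E] [InnerProductSpace ℝ E]
    (p : ℕ → Y → E) {w : ℕ → ℝ} (hw : ∀ n, 0 ≤ w n) (N : ℕ) :
    (Matrix.of fun x y =>
      Real.exp (-∑ n ∈ Finset.range N, w n * ‖p n x - p n y‖ ^ 2)).PosSemidef := by
  induction N with
  | zero => simpa using posSemidef_const_one (Y := Y)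
  | succ N ih =>
    refine (congrArg Matrix.PosSemidef ?_).mp (posSemidef_mul ih (posSemidef_gaussian (p N) (hw N)))
    ext x y
    simp only [of_apply, ← Real.exp_add, Finset.sum_range_succ]
    congr 1
    ring

/-- The orthogonal direct sum of a family of positive semidefinite kernels. -/
theorem posSemidef_sigma {I Z : Type*} [DecidableEq I] {k : I → Matrix Z Z ℝ}
    (hk : ∀ i, (k i).PosSemidef) :
    (Matrix.of fun p q : I × Z => if p.1 = q.1 then k p.1 p.2 q.2 else 0).PosSemidef := by
  refine ⟨?_, fun f => ?_⟩
  · ext p q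
    by_cases h : p.1 = q.1
    · simpa [h] using (hk q.1).1.apply p.2 q.2
    · simp [h, Ne.symm h]
  · have h1 : ∀ i : I, 0 ≤ ∑ p ∈ f.support with p.1 = i, ∑ q ∈ f.support with q.1 = i,
        f p * k i p.2 q.2 * f q := by
      intro i
      have := ((hk i).submatrix (Prod.snd : I × Z → Z)).2 (f.filter fun p => p.1 = i)
      simp only [Finsupp.sum, Finsupp.support_filter, submatrix_apply, star_trivial] at this
      refine this.trans_eq (Finset.sum_congr rfl fun p hp => Finset.sum_congr rfl fun q hq => ?_)
      simp [(Finset.mem_filter.1 hp).2, (Finset.mem_filter.1 hq).2]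
    have h2 := Finset.sum_nonneg fun i (_ : i ∈ f.support.image Prod.fst) => h1 i
    refine h2.trans_eq ?_
    rw [Finsupp.sum, ← Finset.sum_fiberwise_of_maps_to (s := f.support)
      (t := f.support.image Prod.fst) (g := Prod.fst) fun p hp => Finset.mem_image_of_mem _ hp]
    refine Finset.sum_congr rfl fun i _ => Finset.sum_congr rfl fun p hp => ?_
    rw [Finset.sum_filter, Finsupp.sum]
    refine Finset.sum_congr rfl fun q _ => ?_
    have hpi := (Finset.mem_filter.1 hp).2
    subst hpi
    by_cases h : q.1 = p.1
    · simp [h]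
    · simp [h, Ne.symm h]

/-- A positive semidefinite kernel is the Gram matrix of a total family in a Hilbert space. -/
theorem exists_gram_eq {Y : Type u} (k : Matrix Y Y ℝ) (hk : k.PosSemidef) :
    ∃ (E : Type u) (_ : NormedAddCommGroup E) (_ : InnerProductSpace ℝ E) (_ : CompleteSpace E)
      (κ : Y → E), (∀ x y, inner ℝ (κ x) (κ y) = k x y) ∧
        DenseRange (Finsupp.linearCombination ℝ κ) := by
  let K : Matrix Y Y (ℝ →L[ℝ] ℝ) := Matrix.of fun x y => k x y • 1
  have hsymm : ∀ x y, k y x = k x y := fun x y => by simpa using hk.1.apply x y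
  have hK : K.PosSemidef := by
    have h := (RKHS.posSemidef_tfae (K := K)).out 0 2
    refine h.2 ⟨?_, fun f => ?_⟩
    · ext x y
      simp [K, hsymm x y]
    · refine (hk.2 f).trans_eq ?_
      simp [K, Finsupp.sum, hsymm, mul_comm, mul_left_comm]
  have : Fact K.PosSemidef := ⟨hK⟩
  refine ⟨RKHS.OfKernel K, inferInstance, inferInstance, inferInstance,
    fun x => RKHS.kerFun (RKHS.OfKernel K) x 1, fun x y => ?_, ?_⟩
  · rw [← RKHS.kernel_inner, RKHS.OfKernel.kernel_ofKernel]
    simp [K, hsymm x y]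
  · have h1 := RKHS.kerFun_dense (𝕜 := ℝ) (RKHS.OfKernel K)
    rw [← Submodule.dense_iff_topologicalClosure_eq_top] at h1
    change Dense (Set.range _)
    rw [← LinearMap.coe_range, Finsupp.range_linearCombination]
    refine h1.mono (Submodule.span_le.2 ?_)
    rintro _ ⟨x, v, rfl⟩
    have : RKHS.kerFun (RKHS.OfKernel K) x v = v • RKHS.kerFun (RKHS.OfKernel K) x 1 := by
      rw [← map_smul, smul_eq_mul, mul_one]
    rw [this]
    exact Submodule.smul_mem _ _ (Submodule.subset_span ⟨x, rfl⟩)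

end Kernels

/-! ### Representations attached to invariant kernels -/

section KernelRep

variable {G : Type u} [Group G] [TopologicalSpace G] [IsTopologicalGroup G]

/-- An invariant positive semidefinite kernel on a `G`-set is the Gram matrix of an equivariant total
family of vectors in an orthogonal representation. Continuity of the kernel at the identity makes the
representation continuous. -/
theorem OrthRep.exists_of_invariant_kernel {Y : Type u} [MulAction G Y] (k : Matrix Y Y ℝ)
    (hk : k.PosSemidef) (hinv : ∀ (g : G) (x y : Y), k (g • x) (g • y) = k x y)
    (hcont : ∀ y : Y, ContinuousAt (fun g : G => k y (g • y)) 1) :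
    ∃ (E : Type u) (_ : NormedAddCommGroup E) (_ : InnerProductSpace ℝ E) (_ : CompleteSpace E)
      (ρ : OrthRep G E) (κ : Y → E), (∀ x y, inner ℝ (κ x) (κ y) = k x y) ∧
        DenseRange (Finsupp.linearCombination ℝ κ) ∧
        ∀ (g : G) (y : Y), ρ.toHom g (κ y) = κ (g • y) := by
  obtain ⟨E, _, _, _, κ, hκ, hd⟩ := exists_gram_eq k hk
  have hnorm : ∀ (g : G) (f : Y →₀ ℝ),
      ‖Finsupp.linearCombination ℝ κ (Finsupp.domLCongr (R := ℝ) (M := ℝ) (MulAction.toPerm g) f)‖ =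
        ‖Finsupp.linearCombination ℝ κ f‖ := by
    intro g f
    have h1 : Finsupp.linearCombination ℝ κ
        (Finsupp.domLCongr (R := ℝ) (M := ℝ) (MulAction.toPerm g) f) =
        Finsupp.linearCombination ℝ (fun y => κ (g • y)) f :=
      Finsupp.linearCombination_equivMapDomain _ _ _
    rw [h1, ← sq_eq_sq₀ (norm_nonneg _) (norm_nonneg _), ← real_inner_self_eq_norm_sq,
      ← real_inner_self_eq_norm_sq]
    simp only [Finsupp.linearCombination_apply, Finsupp.sum, sum_inner, inner_sum,
      inner_smul_left, inner_smul_right, hκ, hinv]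
  let T : G → E ≃ₗᵢ[ℝ] E := fun g =>
    (Finsupp.domLCongr (R := ℝ) (M := ℝ) (MulAction.toPerm g)).extendOfIsometry
      (Finsupp.linearCombination ℝ κ) (Finsupp.linearCombination ℝ κ) hd hd (hnorm g)
  have hT : ∀ (g : G) (y : Y), T g (κ y) = κ (g • y) := by
    intro g y
    have h1 := LinearEquiv.extendOfIsometry_eq
      (Finsupp.domLCongr (R := ℝ) (M := ℝ) (MulAction.toPerm g))
      (Finsupp.linearCombination ℝ κ) (Finsupp.linearCombination ℝ κ) hd hd (hnorm g)
      (Finsupp.single y 1)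
    simpa using h1
  have hd' : Dense (Submodule.span ℝ (Set.range κ) : Set E) := by
    rw [← Finsupp.range_linearCombination]
    exact hd
  have hext : ∀ S S' : E ≃ₗᵢ[ℝ] E, (∀ y, S (κ y) = S' (κ y)) → S = S' := by
    intro S S' h
    have := ContinuousLinearMap.ext_on (f := (S : E →L[ℝ] E)) (g := (S' : E →L[ℝ] E)) hd' (by
      rintro _ ⟨y, rfl⟩
      exact h y)
    ext x
    exact congrArg (fun A : E →L[ℝ] E => A x) this
  let ψ : G →* (E ≃ₗᵢ[ℝ] E) :=
    { toFun := T
      map_one' := hext _ _ fun y => by simp [hT]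
      map_mul' := fun g h => hext _ _ fun y => by simp [hT, mul_smul] }
  have hκcont : ∀ y, Continuous fun g => ψ g (κ y) := by
    intro y
    rw [continuous_iff_continuousAt]
    intro g₀
    have h1 : ∀ g, dist (ψ g (κ y)) (ψ g₀ (κ y)) =
        Real.sqrt (2 * k y y - 2 * k y ((g₀⁻¹ * g) • y)) := by
      intro g
      have h2 : ψ g (κ y) = ψ g₀ (κ ((g₀⁻¹ * g) • y)) := by
        change T g (κ y) = T g₀ _
        rw [hT, hT, smul_smul, mul_inv_cancel_left]
      rw [h2, LinearIsometryEquiv.dist_map, dist_eq_norm', eq_comm,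
        Real.sqrt_eq_iff_eq_sq _ (norm_nonneg _), norm_sub_sq_real,
        ← real_inner_self_eq_norm_sq, ← real_inner_self_eq_norm_sq, hκ, hκ, hκ, hinv]
      · ring
      · have := norm_sub_sq_real (κ y) (κ ((g₀⁻¹ * g) • y))
        rw [← real_inner_self_eq_norm_sq (κ y), ← real_inner_self_eq_norm_sq (κ (_ • y)), hκ, hκ,
          hκ, hinv] at this
        nlinarith [sq_nonneg ‖κ y - κ ((g₀⁻¹ * g) • y)‖]
    rw [ContinuousAt, tendsto_iff_dist_tendsto_zero]
    simp_rw [h1]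
    have h3 : Tendsto (fun g : G => g₀⁻¹ * g) (𝓝 g₀) (𝓝 1) := by
      have : Continuous fun g : G => g₀⁻¹ * g := by fun_prop
      simpa using this.tendsto g₀
    have h4 : Tendsto (fun g : G => k y (g • y)) (𝓝 1) (𝓝 (k y y)) := by
      simpa [ContinuousAt] using hcont y
    have h5 := (((h4.comp h3).const_mul 2).const_sub (2 * k y y)).sqrt
    simpa using h5
  refine ⟨E, inferInstance, inferInstance, inferInstance, ⟨ψ, fun x => ?_⟩, κ, hκ, hd, hT⟩
  have hS : ∀ x ∈ (Submodule.span ℝ (Set.range κ) : Set E), Continuous fun g => ψ g x := by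
    intro x hx
    induction hx using Submodule.span_induction with
    | mem x h =>
      obtain ⟨y, rfl⟩ := h
      exact hκcont y
    | zero => simpa using continuous_const
    | add x y _ _ hx hy =>
      simp only [map_add]
      exact hx.add hy
    | smul a x _ hx =>
      simp only [map_smul]
      exact hx.const_smul a
  rw [continuous_iff_continuousAt]
  intro g₀
  rw [ContinuousAt, Metric.tendsto_nhds]
  intro ε hε
  obtain ⟨x', hx', hxs⟩ := Metric.dense_iff.1 hd' x (ε / 3) (by positivity)
  filter_upwards [Metric.tendsto_nhds.1 ((hS x' hxs).tendsto g₀) (ε / 3) (by positivity)] with g hg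
  have h2 := dist_triangle4 (ψ g x) (ψ g x') (ψ g₀ x') (ψ g₀ x)
  rw [LinearIsometryEquiv.dist_map, LinearIsometryEquiv.dist_map, dist_comm x x'] at h2
  have := Metric.mem_ball.1 hx'
  linarith

end KernelRep

section Kazhdan

variable {H Q : Type u} [Group H] [TopologicalSpace H] [IsTopologicalGroup H]
  [Group Q] [TopologicalSpace Q] [IsTopologicalGroup Q] {π : H →* Q} {hπ : DenseRange π}

/-- Consider a family of normalized continuous functions of positive type on `H` which approximates
`1` uniformly on compact sets. Then a member of the family is bounded away from zero on `π⁻¹(W)`,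
`W` a neighbourhood of `1`, up to finitely many translations. -/
theorem IsKazhdanHom.exists_le_of_approx_one (hK : IsKazhdanHom π hπ) {I : Type u} (φ : I → H → ℝ)
    (hpsd : ∀ i, (Matrix.of fun g h => φ i (g⁻¹ * h)).PosSemidef) (hone : ∀ i, φ i 1 = 1)
    (hnonneg : ∀ i g, 0 ≤ φ i g)
    (hcont : ∀ i, ContinuousAt (φ i) 1)
    (happrox : ∀ K : Set H, IsCompact K → ∀ ε : ℝ, 0 < ε → ∃ i, ∀ g ∈ K, 1 - ε ≤ φ i g) :
    ∃ i, ∃ c : ℝ, 0 < c ∧ ∃ (s : Finset H) (g₀ : H),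
      ∀ᶠ h in comap π (𝓝 1), ∃ g ∈ s, c ≤ φ i (g * h * g₀) := by
  classical
  -- The direct sum over `I` of the cyclic representations defined by the functions `φ i`.
  let act : MulAction H (I × H) :=
    { smul := fun g p => (p.1, g * p.2)
      one_smul := fun p => Prod.ext rfl (one_mul _)
      mul_smul := fun a b p => Prod.ext rfl (mul_assoc _ _ _) }
  have hact : ∀ (g : H) (p : I × H), g • p = (p.1, g * p.2) := fun _ _ => rfl
  obtain ⟨E, _, _, _, ρ, κ, hκ, hd, hρ⟩ := OrthRep.exists_of_invariant_kernel (G := H) _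
    (posSemidef_sigma hpsd) (fun g x y => by simp [hact, mul_assoc]) (fun y => by
      have h1 : Tendsto (fun g : H => y.2⁻¹ * (g * y.2)) (𝓝 1) (𝓝 1) := by
        have : Continuous fun g : H => y.2⁻¹ * (g * y.2) := by fun_prop
        simpa using this.tendsto 1
      have h2 := (hcont y.1).tendsto.comp h1
      simpa [ContinuousAt, hact, Function.comp_def] using h2)
  have hκnorm : ∀ p, ‖κ p‖ = 1 := by
    intro p
    rw [← sq_eq_sq₀ (norm_nonneg _) zero_le_one, ← real_inner_self_eq_norm_sq, hκ]
    simp [hone]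
  have hinv : ρ.AlmostHasInvariantVectors := by
    intro K hKc ε hε
    obtain ⟨i, hi⟩ := happrox K hKc (ε ^ 2 / 2) (by positivity)
    refine ⟨κ (i, 1), hκnorm _, fun g hg => ?_⟩
    refine (sq_le_sq₀ (norm_nonneg _) hε.le).1 ?_
    rw [norm_sub_sq_real, LinearIsometryEquiv.norm_map, hκnorm, hρ, hκ]
    have := hi g hg
    simp only [hact, Matrix.of_apply, inv_one, one_mul, mul_one, if_true]
    linarith
  -- Hence there is a nonzero `Q`-point `ξ`; it is not orthogonal to some cyclic translate `κ p`.
  obtain ⟨ξ, hξ, -⟩ := hK E ρ hinv ∅ isCompact_empty 1 one_pos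
  obtain ⟨p, hp⟩ : ∃ p, inner ℝ (ξ : E) (κ p) ≠ 0 := by
    by_contra! h
    have h0 : (ξ : E) = 0 := by
      refine hd.eq_zero_of_inner_left ℝ fun f => ?_
      simp [Finsupp.linearCombination_apply, Finsupp.sum, inner_sum, inner_smul_right, h]
    have h1 : ‖(ξ : E)‖ = 1 := hξ
    simp [h0] at h1
  set δ : ℝ := |inner ℝ (ξ : E) (κ p)| with hδdef
  have hδ : 0 < δ := abs_pos.2 hp
  -- Approximate `ξ` by a finite combination of the `κ q`. As `⟪h ξ, κ (h • p)⟫` does not depend on `h`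
  -- and `h ξ` is close to `ξ`, one of the finitely many `⟪κ q, κ (h • p)⟫` cannot be small.
  obtain ⟨f, hf⟩ := hd.exists_dist_lt (ξ : E) (show 0 < δ / 3 by positivity)
  set M : ℝ := ∑ q ∈ f.support, |f q| with hM
  have hM0 : 0 ≤ M := Finset.sum_nonneg fun _ _ => abs_nonneg _
  refine ⟨p.1, δ / (3 * (M + 1)), by positivity, f.support.image fun q => q.2⁻¹, p.2, ?_⟩
  have hξQ := (ρ.mem_qPoints π ξ).1 ξ.2 (δ / 3) (by positivity)
  rw [← eventually_comap] at hξQ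
  filter_upwards [hξQ] with h hh
  by_contra! hcon
  have hlt : ∀ q ∈ f.support, |f q * inner ℝ (κ q) (κ (h • p))| ≤ |f q| * (δ / (3 * (M + 1))) := by
    intro q hq
    rw [abs_mul]
    refine mul_le_mul_of_nonneg_left ?_ (abs_nonneg _)
    rw [hκ]
    by_cases hqp : q.1 = p.1
    · have h1 := hcon q.2⁻¹ (Finset.mem_image_of_mem _ hq)
      rw [mul_assoc] at h1
      simp only [hact, Matrix.of_apply, hqp, if_true]
      rw [abs_of_nonneg (hnonneg _ _)]
      exact h1.le
    · simp only [hact, Matrix.of_apply, hqp, if_false, abs_zero]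
      positivity
  have hz : |inner ℝ (Finsupp.linearCombination ℝ κ f) (κ (h • p))| < δ / 3 := by
    simp only [Finsupp.linearCombination_apply, Finsupp.sum, sum_inner, inner_smul_left,
      conj_trivial]
    refine (Finset.abs_sum_le_sum_abs _ _).trans_lt ((Finset.sum_le_sum hlt).trans_lt ?_)
    rw [← Finset.sum_mul, ← hM, mul_div_assoc', div_lt_div_iff₀ (by positivity) (by positivity)]
    nlinarith
  have h1 : inner ℝ (ξ : E) (κ p) = inner ℝ (ρ.toHom h ξ) (κ (h • p)) := by
    rw [← hρ, LinearIsometryEquiv.inner_map_map]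
  have h2 : |inner ℝ ((ξ : E) - ρ.toHom h ξ) (κ (h • p))| ≤ δ / 3 := by
    refine (abs_real_inner_le_norm _ _).trans ?_
    rw [hκnorm, mul_one, ← dist_eq_norm]
    exact hh
  have h3 : |inner ℝ ((ξ : E) - Finsupp.linearCombination ℝ κ f) (κ (h • p))| < δ / 3 := by
    refine (abs_real_inner_le_norm _ _).trans_lt ?_
    rw [hκnorm, mul_one, ← dist_eq_norm]
    exact hf
  rw [inner_sub_left] at h2 h3
  rw [← h1] at h2
  have h4 : δ ≤ _ := hδdef.le
  rw [abs_lt] at h3 hz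
  rw [abs_le] at h2
  rcases abs_cases (inner ℝ (ξ : E) (κ p)) with h5 | h5 <;> linarith [h5.1]

end Kazhdan

/-! ### Cocycles of the source of a Kazhdan homomorphism -/

namespace OrthRep

section Cocycles

variable {G : Type u} [Group G] [TopologicalSpace G]
  {E : Type v} [NormedAddCommGroup E] [InnerProductSpace ℝ E] {ρ : OrthRep G E}

theorem Z1.map_mul (b : ρ.Z1) (g h : G) : b.1 (g * h) = ρ.toHom g (b.1 h) + b.1 g := b.2 g h

theorem Z1.map_one (b : ρ.Z1) : b.1 1 = 0 := by
  have := Z1.map_mul b 1 1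
  simpa using this

theorem Z1.dist_eq (b : ρ.Z1) (g h : G) : ‖b.1 g - b.1 h‖ = ‖b.1 (g⁻¹ * h)‖ := by
  have h1 := Z1.map_mul b g (g⁻¹ * h)
  rw [mul_inv_cancel_left] at h1
  rw [h1, norm_sub_rev, add_sub_cancel_right, LinearIsometryEquiv.norm_map]

theorem coboundary_apply (ξ : E) (g : G) : (ρ.coboundary ξ).1 g = ξ - ρ.toHom g ξ := rfl

theorem norm_coboundary_le (ξ : E) (g : G) : ‖(ρ.coboundary ξ).1 g‖ ≤ 2 * ‖ξ‖ := by
  rw [coboundary_apply]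
  refine (norm_sub_le _ _).trans ?_
  rw [LinearIsometryEquiv.norm_map]
  linarith

end Cocycles

end OrthRep

section DenseRange

variable {H Q : Type*} [Group H] [Group Q] [TopologicalSpace Q] [IsTopologicalGroup Q] {π : H →* Q}

theorem eventually_eventually_comap_mul {p : H → Prop} (hp : ∀ᶠ h in comap π (𝓝 1), p h) :
    ∀ᶠ k in comap π (𝓝 1), ∀ᶠ h in comap π (𝓝 1), p (k * h) := by
  rw [eventually_comap] at hp ⊢
  filter_upwards [eventually_eventually_nhds.2 hp] with q hq k hk
  subst hk
  have h1 : Tendsto (fun q : Q => π k * q) (𝓝 1) (𝓝 (π k)) := by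
    have : Continuous fun q : Q => π k * q := by fun_prop
    simpa using this.tendsto 1
  rw [eventually_comap]
  filter_upwards [h1.eventually hq] with q hq' h hh
  exact hq' _ (by rw [_root_.map_mul, hh])

/-- A map on `H` which is uniformly continuous for the left uniform structure pulled back from `Q`
extends continuously to `Q`. -/
theorem exists_continuousMap_comp_eq (hπ : DenseRange π) {F : Type*} [NormedAddCommGroup F]
    [CompleteSpace F] (f : H → F)
    (hf : ∀ ε : ℝ, 0 < ε → ∀ᶠ h in comap π (𝓝 1), ∀ g, dist (f g) (f (g * h)) ≤ ε) :
    ∃ F' : C(Q, F), ∀ h, F' (π h) = f h := by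
  have hlim : ∀ q : Q, ∃ y, Tendsto f (comap π (𝓝 q)) (𝓝 y) := by
    intro q
    have := OrthRep.comap_neBot hπ q
    refine CompleteSpace.complete (f := map f (comap π (𝓝 q))) ?_
    rw [Metric.cauchy_iff]
    refine ⟨inferInstance, fun ε hε => ?_⟩
    have hc : Tendsto (fun p : Q × Q => p.1⁻¹ * p.2) (𝓝 q ×ˢ 𝓝 q) (𝓝 1) := by
      have : Continuous fun p : Q × Q => p.1⁻¹ * p.2 := by fun_prop
      have h := this.tendsto (q, q)
      rwa [nhds_prod_eq, inv_mul_cancel] at h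
    have h0 := hf (ε / 2) (by positivity)
    rw [eventually_comap] at h0
    obtain ⟨t, ht, h2⟩ := (eventually_prod_self_iff
      (r := fun a b : Q => ∀ h : H, π h = a⁻¹ * b → ∀ g, dist (f g) (f (g * h)) ≤ ε / 2)).1
      (hc.eventually h0)
    refine ⟨f '' (π ⁻¹' t), image_mem_map (preimage_mem_comap ht), ?_⟩
    rintro _ ⟨h, hh, rfl⟩ _ ⟨h', hh', rfl⟩
    have := h2 _ hh _ hh' (h⁻¹ * h') (by simp) h
    rw [mul_inv_cancel_left] at this
    linarith
  let _ : TopologicalSpace H := .induced π inferInstance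
  have di : IsDenseInducing π := ⟨⟨rfl⟩, hπ⟩
  exact ⟨⟨di.extend f, di.continuous_extend hlim⟩, di.extend_eq' hlim⟩

end DenseRange

section Bounded

open OrthRep

variable {H Q : Type u} [Group H] [TopologicalSpace H]
  [Group Q] [TopologicalSpace Q] [IsTopologicalGroup Q] {π : H →* Q} {hπ : DenseRange π}
  {E : Type v} [NormedAddCommGroup E] [InnerProductSpace ℝ E] {ρ : OrthRep H E}

/-- The functions `exp (-‖b‖² / (n + 1))` are of positive type and tend to `1` uniformly on compact
sets, whence the bound. -/
theorem IsKazhdanHom.eventually_norm_cocycle_le [IsTopologicalGroup H]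
    (hK : IsKazhdanHom π hπ) (b : ρ.Z1) :
    ∃ C : ℝ, ∀ᶠ h in comap π (𝓝 1), ‖b.1 h‖ ≤ C := by
  obtain ⟨n, c, hc, s, g₀, hev⟩ := hK.exists_le_of_approx_one (I := ULift.{u} ℕ)
    (fun n h => Real.exp (-(((n.down : ℝ) + 1)⁻¹ * ‖b.1 h‖ ^ 2)))
    (fun n => by
      have := posSemidef_gaussian (fun h => b.1 h) (w := ((n.down : ℝ) + 1)⁻¹) (by positivity)
      simpa only [Z1.dist_eq] using this)
    (fun n => by simp [Z1.map_one]) (fun n g => (Real.exp_pos _).le)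
    (fun n => by
      have := b.1.continuous
      fun_prop)
    (fun K hKc ε hε => by
      obtain ⟨C, hC⟩ := hKc.exists_bound_of_continuousOn b.1.continuous.continuousOn
      obtain ⟨n, hn⟩ := exists_nat_gt (C ^ 2 / ε)
      refine ⟨⟨n⟩, fun g hg => ?_⟩
      refine le_trans ?_ (Real.one_sub_le_exp_neg _)
      have h1 : ‖b.1 g‖ ^ 2 ≤ C ^ 2 := pow_le_pow_left₀ (norm_nonneg _) (hC g hg) 2
      rw [div_lt_iff₀ hε] at hn
      have h2 : ((n : ℝ) + 1)⁻¹ * ‖b.1 g‖ ^ 2 ≤ ε := by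
        rw [inv_mul_le_iff₀ (by positivity)]
        nlinarith
      dsimp only
      linarith)
  obtain ⟨D, hD⟩ : ∃ D, ∀ g ∈ s, ‖b.1 g‖ ≤ D := by
    obtain ⟨D, hD⟩ := (s.image fun g => ‖b.1 g‖).bddAbove
    exact ⟨D, fun g hg => hD (by simpa using ⟨g, hg, rfl⟩)⟩
  refine ⟨D + Real.sqrt (-Real.log c * (n.down + 1)) + ‖b.1 g₀‖, ?_⟩
  filter_upwards [hev] with h hh
  obtain ⟨g, hg, hgc⟩ := hh
  rw [← Real.log_le_iff_le_exp hc] at hgc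
  have h1 : ‖b.1 (g * h * g₀)‖ ^ 2 ≤ -Real.log c * (n.down + 1) := by
    have h2 : ((n.down : ℝ) + 1)⁻¹ * ‖b.1 (g * h * g₀)‖ ^ 2 ≤ -Real.log c := by linarith
    rwa [inv_mul_le_iff₀ (by positivity), mul_comm] at h2
  have h2 := Real.le_sqrt_of_sq_le h1
  have h3 : b.1 (g * h * g₀) = ρ.toHom (g * h) (b.1 g₀) + (ρ.toHom g (b.1 h) + b.1 g) := by
    rw [Z1.map_mul, Z1.map_mul]
  have h4 : ‖b.1 h‖ = ‖b.1 (g * h * g₀) - ρ.toHom (g * h) (b.1 g₀) - b.1 g‖ := by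
    rw [h3, add_sub_cancel_left, add_sub_cancel_right, LinearIsometryEquiv.norm_map]
  rw [h4]
  refine (norm_sub_le _ _).trans ?_
  have h5 := norm_sub_le (b.1 (g * h * g₀)) (ρ.toHom (g * h) (b.1 g₀))
  rw [LinearIsometryEquiv.norm_map] at h5
  linarith [hD g hg]

/-- A cocycle bounded near the kernel of `π` is cohomologous to one tending to `0` there. The vector
`ξ` is the limit of the centres of nearly minimal balls containing `b (π⁻¹(W))`, as `W` shrinks to
`1`. -/
theorem OrthRep.Z1.exists_tendsto_zero_of_bounded [CompleteSpace E] (b : ρ.Z1) {C : ℝ}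
    (hC : ∀ᶠ h in comap π (𝓝 1), ‖b.1 h‖ ≤ C) :
    ∃ ξ : E, Tendsto (fun h => (b - ρ.coboundary ξ).1 h) (comap π (𝓝 1)) (𝓝 0) := by
  have hne : (comap π (𝓝 1)).NeBot := by
    rw [comap_neBot_iff]
    exact fun t ht => ⟨1, by simpa using mem_of_mem_nhds ht⟩
  -- `r` is the infimum of the squared radii of balls containing `b (π⁻¹(W))` for some `W`, and `P ε c`
  -- says that `c` is the centre of such a ball of squared radius `r + ε`.
  let R : Set ℝ := {r | ∃ c : E, ∀ᶠ h in comap π (𝓝 1), ‖b.1 h - c‖ ^ 2 ≤ r}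
  have hRne : R.Nonempty := ⟨C ^ 2, 0, by
    filter_upwards [hC] with h hh
    rw [sub_zero]
    exact pow_le_pow_left₀ (norm_nonneg _) hh 2⟩
  have hRbdd : BddBelow R := ⟨0, by
    rintro r ⟨c, hc⟩
    obtain ⟨h, hh⟩ := hc.exists
    exact (sq_nonneg _).trans hh⟩
  set r := sInf R with hr
  let P : ℝ → E → Prop := fun ε c => ∀ᶠ h in comap π (𝓝 1), ‖b.1 h - c‖ ^ 2 ≤ r + ε
  have hPmono : ∀ {ε ε' c}, ε ≤ ε' → P ε c → P ε' c := fun hεε' hc => by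
    filter_upwards [hc] with h hh
    linarith
  have hPex : ∀ ε : ℝ, 0 < ε → ∃ c, P ε c := by
    intro ε hε
    obtain ⟨r', ⟨c, hc⟩, hr'⟩ := exists_lt_of_csInf_lt hRne (show sInf R < r + ε by linarith)
    exact ⟨c, hc.mono fun h hh => hh.trans hr'.le⟩
  -- Two such centres are close to each other, since their midpoint would otherwise beat `r`.
  have hPdist : ∀ {ε c c'}, P ε c → P ε c' → ‖c - c'‖ ^ 2 ≤ 4 * ε := by
    intro ε c c' hc hc'
    have hmem : r + ε - ‖c - c'‖ ^ 2 / 4 ∈ R := by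
      refine ⟨(1 / 2 : ℝ) • (c + c'), ?_⟩
      filter_upwards [hc, hc'] with h h1 h2
      have h3 := parallelogram_law_with_norm ℝ (b.1 h - c) (b.1 h - c')
      have h4 : b.1 h - c + (b.1 h - c') = (2 : ℝ) • (b.1 h - (1 / 2 : ℝ) • (c + c')) := by
        module
      have h5 : b.1 h - c - (b.1 h - c') = c' - c := by abel
      rw [h4, h5, norm_smul, norm_sub_rev c' c, Real.norm_two] at h3
      nlinarith
    have := csInf_le hRbdd hmem
    linarith
  -- The affine action of `k ∈ π⁻¹(W)` sends a centre to a centre.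
  have hPmul : ∀ {ε c}, P ε c → ∀ᶠ k in comap π (𝓝 1),
      ‖(b - ρ.coboundary c).1 k‖ ^ 2 ≤ 4 * ε := by
    intro ε c hc
    filter_upwards [eventually_eventually_comap_mul hc] with k hk
    have h1 : P ε (ρ.toHom k⁻¹ (c - b.1 k)) := by
      filter_upwards [hk] with h hh
      have h2 : ‖b.1 h - ρ.toHom k⁻¹ (c - b.1 k)‖ = ‖b.1 (k * h) - c‖ := by
        rw [← LinearIsometryEquiv.norm_map (ρ.toHom k), map_sub, ← toHom_mul_apply,
          mul_inv_cancel, _root_.map_one, Z1.map_mul]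
        congr 1
        simp only [LinearIsometryEquiv.coe_one, id]
        abel
      rwa [h2]
    refine le_of_eq_of_le ?_ (hPdist h1 hc)
    congr 1
    rw [← LinearIsometryEquiv.norm_map (ρ.toHom k) (_ - c), map_sub, ← toHom_mul_apply,
      mul_inv_cancel, _root_.map_one, norm_sub_rev]
    congr 1
    change b.1 k - (c - ρ.toHom k c) = ρ.toHom k c - (c - b.1 k)
    abel
  choose c hc using fun n : ℕ => hPex (((n : ℝ) + 1)⁻¹) (by positivity)
  have hcdist : ∀ N n, N ≤ n → ‖c n - c N‖ ^ 2 ≤ 4 * ((N : ℝ) + 1)⁻¹ := by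
    intro N n hNn
    refine hPdist (hPmono ?_ (hc n)) (hc N)
    gcongr
  have hsmall : ∀ ε : ℝ, 0 < ε → ∃ N : ℕ, 4 * ((N : ℝ) + 1)⁻¹ < ε ^ 2 := by
    intro ε hε
    obtain ⟨N, hN⟩ := exists_nat_one_div_lt (show 0 < ε ^ 2 / 4 by positivity)
    rw [one_div] at hN
    exact ⟨N, by linarith⟩
  have hcauchy : CauchySeq c := by
    rw [Metric.cauchySeq_iff']
    intro ε hε
    obtain ⟨N, hN⟩ := hsmall ε hε
    refine ⟨N, fun n hn => ?_⟩
    rw [dist_eq_norm]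
    exact lt_of_pow_lt_pow_left₀ 2 hε.le ((hcdist N n hn).trans_lt hN)
  obtain ⟨ξ, hξ⟩ := cauchySeq_tendsto_of_complete hcauchy
  refine ⟨ξ, ?_⟩
  rw [Metric.tendsto_nhds]
  intro ε hε
  obtain ⟨N, hN⟩ := hsmall (ε / 4) (by positivity)
  have h1 : ‖ξ - c N‖ ≤ ε / 4 := by
    refine le_of_tendsto ((hξ.sub_const (c N)).norm) ?_
    filter_upwards [eventually_ge_atTop N] with n hn
    exact (lt_of_pow_lt_pow_left₀ 2 (by positivity) ((hcdist N n hn).trans_lt hN)).le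
  filter_upwards [hPmul (hc N)] with k hk
  have h2 : ‖(b - ρ.coboundary (c N)).1 k‖ < ε / 4 :=
    lt_of_pow_lt_pow_left₀ 2 (by positivity) (hk.trans_lt hN)
  have h3 : (b - ρ.coboundary ξ).1 k =
      (b - ρ.coboundary (c N)).1 k - (ρ.coboundary (ξ - c N)).1 k := by
    rw [map_sub]
    change b.1 k - (ρ.coboundary ξ).1 k = b.1 k - (ρ.coboundary (c N)).1 k -
      ((ρ.coboundary ξ).1 k - (ρ.coboundary (c N)).1 k)
    abel
  rw [dist_zero_right, h3]
  refine (norm_sub_le _ _).trans_lt ?_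
  have := norm_coboundary_le (ρ := ρ) (ξ - c N) k
  linarith

theorem OrthRep.Z1.apply_mem_qPoints (b : ρ.Z1)
    (hb : Tendsto (fun h => b.1 h) (comap π (𝓝 1)) (𝓝 0)) (h : H) : b.1 h ∈ ρ.qPoints π := by
  rw [mem_qPoints]
  intro ε hε
  have hb' : ∀ δ : ℝ, 0 < δ → ∀ᶠ q in 𝓝 (1 : Q), ∀ k, π k = q → ‖b.1 k‖ < δ := by
    intro δ hδ
    rw [← eventually_comap]
    simpa using Metric.tendsto_nhds.1 hb δ hδ
  have hc : Tendsto (fun q : Q => (π h)⁻¹ * q * π h) (𝓝 1) (𝓝 1) := by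
    have : Continuous fun q : Q => (π h)⁻¹ * q * π h := by fun_prop
    simpa using this.tendsto 1
  filter_upwards [hb' (ε / 2) (by positivity), hc.eventually (hb' (ε / 2) (by positivity))]
    with q h1 h2 k hk
  have h3 := h1 k hk
  have h4 := h2 (h⁻¹ * k * h) (by simp [hk])
  have h5 : ρ.toHom k (b.1 h) = ρ.toHom h (b.1 (h⁻¹ * k * h)) + b.1 h - b.1 k := by
    rw [eq_sub_iff_add_eq, ← Z1.map_mul, ← Z1.map_mul]
    congr 1
    group
  rw [h5, dist_eq_norm]
  have h6 : b.1 h - (ρ.toHom h (b.1 (h⁻¹ * k * h)) + b.1 h - b.1 k) =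
      b.1 k - ρ.toHom h (b.1 (h⁻¹ * k * h)) := by abel
  rw [h6]
  refine (norm_sub_le _ _).trans ?_
  rw [LinearIsometryEquiv.norm_map]
  linarith

/-- A cocycle tending to `0` along `π⁻¹(W)`, `W → 1`, is the restriction of a cocycle of `Q` with
values in the space of `Q`-points. -/
theorem OrthRep.Z1.exists_qRep_cocycle [CompleteSpace E] (hπ : DenseRange π) (b : ρ.Z1)
    (hb : Tendsto (fun h => b.1 h) (comap π (𝓝 1)) (𝓝 0)) :
    ∃ b' : (ρ.qRep π hπ).Z1, ∀ h, (b'.1 (π h) : E) = b.1 h := by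
  have : CompleteSpace (ρ.qPoints π) := (ρ.isClosed_qPoints π).completeSpace_coe
  obtain ⟨f, hf⟩ := exists_continuousMap_comp_eq hπ
    (fun h => (⟨b.1 h, Z1.apply_mem_qPoints b hb h⟩ : ρ.qPoints π)) (by
      intro ε hε
      filter_upwards [Metric.tendsto_nhds.1 hb ε hε] with h hh g
      rw [Subtype.dist_eq, dist_eq_norm, Z1.dist_eq, inv_mul_cancel_left]
      rw [dist_zero_right] at hh
      exact hh.le)
  have h1 : ∀ (h : H) (q : Q), f (π h * q) = (ρ.qRep π hπ).toHom (π h) (f q) + f (π h) := by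
    intro h
    refine congrFun (hπ.equalizer (f.continuous.comp (continuous_const_mul (π h)))
      ((((ρ.qRep π hπ).toHom (π h)).continuous.comp f.continuous).add continuous_const) ?_)
    funext k
    refine Subtype.ext ?_
    simp only [Function.comp_apply, Submodule.coe_add]
    rw [← _root_.map_mul, hf, hf, hf, qRep_apply]
    exact Z1.map_mul b h k
  refine ⟨⟨f, fun p q => ?_⟩, fun h => by rw [hf]⟩
  refine congrFun (hπ.equalizer (f.continuous.comp (continuous_mul_const q))
    (((ρ.qRep π hπ).continuous_orbit (f q)).add f.continuous) ?_) p
  funext h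
  exact h1 h q

/-- Every cocycle of `H` is cohomologous to one that comes from a cocycle of `Q` with values in the
space of `Q`-points. -/
theorem IsKazhdanHom.exists_qRep_cocycle [IsTopologicalGroup H] [CompleteSpace E]
    (hK : IsKazhdanHom π hπ) (b : ρ.Z1) :
    ∃ (ξ : E) (b' : (ρ.qRep π hπ).Z1), ∀ h, (b'.1 (π h) : E) = b.1 h - (ξ - ρ.toHom h ξ) := by
  obtain ⟨C, hC⟩ := hK.eventually_norm_cocycle_le b
  obtain ⟨ξ, hξ⟩ := Z1.exists_tendsto_zero_of_bounded b hC
  obtain ⟨b', hb'⟩ := Z1.exists_qRep_cocycle hπ (b - ρ.coboundary ξ) hξ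
  exact ⟨ξ, b', hb'⟩

end Bounded

/-! ### Permutation representations from invariant orthonormal sets -/

section OrthonormalSet

variable {G : Type u} [Group G] [TopologicalSpace G]
  {E : Type v} [NormedAddCommGroup E] [InnerProductSpace ℝ E]

theorem Orthonormal.dist_eq_sqrt_two {S : Set E} (hS : Orthonormal ℝ ((↑) : S → E)) {x y : S}
    (hxy : x ≠ y) : dist (x : E) y = Real.sqrt 2 := by
  rw [dist_eq_norm, eq_comm, Real.sqrt_eq_iff_eq_sq (by norm_num) (norm_nonneg _), norm_sub_sq_real,
    hS.1 x, hS.1 y, hS.2 hxy]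
  norm_num

theorem Orthonormal.discreteTopology {S : Set E} (hS : Orthonormal ℝ ((↑) : S → E)) :
    DiscreteTopology S :=
  DiscreteTopology.of_forall_le_dist (r := Real.sqrt 2) (by positivity) fun _ _ hxy =>
    (hS.dist_eq_sqrt_two hxy).ge

theorem Orthonormal.isClosed {S : Set E} (hS : Orthonormal ℝ ((↑) : S → E)) : IsClosed S :=
  Metric.isClosed_of_pairwise_le_dist (ε := Real.sqrt 2) (by positivity) fun x hx y hy hxy =>
    (hS.dist_eq_sqrt_two (x := ⟨x, hx⟩) (y := ⟨y, hy⟩) fun h => hxy (congrArg Subtype.val h)).ge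

/-- The action of `G` on an invariant set of vectors. -/
abbrev OrthRep.actionOn (ρ : OrthRep G E) (S : Set E)
    (hS : ∀ (g : G), ∀ x ∈ S, ρ.toHom g x ∈ S) : MulAction G S where
  smul g x := ⟨ρ.toHom g x, hS g x x.2⟩
  one_smul x := Subtype.ext (by
    change ρ.toHom 1 (x : E) = x
    rw [map_one]
    rfl)
  mul_smul g h x := Subtype.ext (ρ.toHom_mul_apply g h x)

/-- A Hilbert space with an invariant orthonormal basis is the permutation representation on the
basis. -/
theorem OrthRep.exists_equiv_ellTwo [CompleteSpace E] (ρ : OrthRep G E) (S : Set E)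
    (hS : Orthonormal ℝ ((↑) : S → E)) (hinv : ∀ (g : G), ∀ x ∈ S, ρ.toHom g x ∈ S)
    (htot : ∀ x : E, (∀ s ∈ S, inner ℝ s x = 0) → x = 0) :
    letI := ρ.actionOn S hinv
    haveI := hS.discreteTopology
    ∃ _ : ContinuousSMul G S, ∃ T : E ≃ₗᵢ[ℝ] EllTwo S,
      ∀ (g : G) (x : E), T (ρ.toHom g x) = (ellTwoRep G S).toHom g (T x) := by
  let _ := ρ.actionOn S hinv
  have := hS.discreteTopology
  have hact : ∀ (g : G) (s : S), ((g • s : S) : E) = ρ.toHom g s := fun _ _ => rfl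
  have hc : ContinuousSMul G S := by
    refine ⟨?_⟩
    rw [continuous_prod_of_discrete_right]
    exact fun s => Continuous.subtype_mk (ρ.continuous_orbit s) _
  refine ⟨hc, ?_⟩
  have hspan : (Submodule.span ℝ (Set.range ((↑) : S → E)))ᗮ = ⊥ := by
    rw [Submodule.eq_bot_iff]
    intro x hx
    refine htot x fun s hs => ?_
    exact (Submodule.mem_orthogonal _ _).1 hx s (Submodule.subset_span ⟨⟨s, hs⟩, rfl⟩)
  let B := HilbertBasis.mkOfOrthogonalEqBot hS hspan
  refine ⟨B.repr, fun g x => ?_⟩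
  ext s
  change B.repr (ρ.toHom g x) s = B.repr x (g⁻¹ • s)
  rw [HilbertBasis.repr_apply_apply, HilbertBasis.repr_apply_apply,
    HilbertBasis.coe_mkOfOrthogonalEqBot, hact,
    ← LinearIsometryEquiv.inner_map_map (ρ.toHom g⁻¹) (s : E), ← toHom_mul_apply, inv_mul_cancel,
    map_one]
  rfl

end OrthonormalSet

/-! ### The `Q`-points of a permutation representation -/

section Atoms

open OrthRep

variable {H Q : Type u} [Group H] [Group Q] [TopologicalSpace Q]
  (π : H →* Q) {X : Type u} [MulAction H X]

/-- A finite subset of an `H`-set is `Q`-stable if `π⁻¹(W)` leaves it invariant for some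
neighbourhood `W` of `1` in `Q`. -/
def IsQStable (A : Set X) : Prop :=
  A.Finite ∧ ∀ᶠ h in comap π (𝓝 1), ∀ x : X, h • x ∈ A ↔ x ∈ A

/-- An atom is a minimal nonempty `Q`-stable set: every `Q`-stable set contains it or is disjoint
from it. -/
def IsQAtom (A : Set X) : Prop :=
  A.Nonempty ∧ IsQStable π A ∧ ∀ B : Set X, IsQStable π B → (A ∩ B).Nonempty → A ⊆ B

variable {π}

theorem IsQStable.inter {A B : Set X} (hA : IsQStable π A) (hB : IsQStable π B) :
    IsQStable π (A ∩ B) :=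
  ⟨hA.1.subset Set.inter_subset_left, by
    filter_upwards [hA.2, hB.2] with h h1 h2 x
    rw [Set.mem_inter_iff, Set.mem_inter_iff, h1, h2]⟩

theorem IsQStable.diff {A B : Set X} (hA : IsQStable π A) (hB : IsQStable π B) :
    IsQStable π (A \ B) :=
  ⟨hA.1.subset Set.sdiff_subset, by
    filter_upwards [hA.2, hB.2] with h h1 h2 x
    rw [Set.mem_sdiff, Set.mem_sdiff, h1, h2]⟩

/-- A `Q`-stable set containing `x` of minimal cardinality is an atom. -/
theorem IsQStable.exists_atom {A : Set X} (hA : IsQStable π A) {x : X} (hx : x ∈ A) :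
    ∃ A' ⊆ A, x ∈ A' ∧ IsQAtom π A' := by
  classical
  obtain ⟨A', ⟨hA', hxA'⟩, hmin⟩ := WellFounded.has_min
    (InvImage.wf Set.ncard (Nat.lt_wfRel.wf)) {B : Set X | IsQStable π B ∧ x ∈ B} ⟨A, hA, hx⟩
  have hmin' : ∀ B, B ⊆ A' → IsQStable π B → x ∈ B → B = A' := by
    intro B hBA hB hxB
    have : ¬ B.ncard < A'.ncard := hmin B ⟨hB, hxB⟩
    exact Set.eq_of_subset_of_ncard_le hBA (not_lt.1 this) hA'.1
  have hat : IsQAtom π A' := by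
    refine ⟨⟨x, hxA'⟩, hA', fun B hB hne => ?_⟩
    by_cases hxB : x ∈ B
    · have := hmin' _ Set.inter_subset_left (hA'.inter hB) ⟨hxA', hxB⟩
      rw [← this]
      exact Set.inter_subset_right
    · have := hmin' _ Set.sdiff_subset (hA'.diff hB) ⟨hxA', hxB⟩
      obtain ⟨y, hyA, hyB⟩ := hne
      rw [← this] at hyA
      exact absurd hyB hyA.2
  refine ⟨A', ?_, hxA', hat⟩
  exact hat.2.2 A hA ⟨x, hxA', hx⟩

theorem IsQAtom.finite {A : Set X} (hA : IsQAtom π A) : A.Finite := hA.2.1.1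

theorem IsQAtom.eq_of_mem {A B : Set X} (hA : IsQAtom π A) (hB : IsQAtom π B) {x : X}
    (hxA : x ∈ A) (hxB : x ∈ B) : A = B :=
  Set.Subset.antisymm (hA.2.2 B hB.2.1 ⟨x, hxA, hxB⟩) (hB.2.2 A hA.2.1 ⟨x, hxB, hxA⟩)

variable [IsTopologicalGroup Q]

theorem IsQStable.smul {A : Set X} (hA : IsQStable π A) (g : H) :
    IsQStable π ((fun x => g⁻¹ • x) ⁻¹' A) := by
  refine ⟨hA.1.preimage (MulAction.injective g⁻¹).injOn, ?_⟩
  have h1 : Tendsto (fun h : H => g⁻¹ * h * g) (comap π (𝓝 1)) (comap π (𝓝 1)) := by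
    rw [tendsto_comap_iff]
    have h2 : Tendsto (fun q : Q => (π g)⁻¹ * q * π g) (𝓝 1) (𝓝 1) := by
      have : Continuous fun q : Q => (π g)⁻¹ * q * π g := by fun_prop
      simpa using this.tendsto 1
    refine (h2.comp tendsto_comap).congr fun h => ?_
    simp
  filter_upwards [h1.eventually hA.2] with h hh x
  have := hh (g⁻¹ • x)
  rw [smul_smul, mul_assoc, mul_inv_cancel, mul_one, mul_smul] at this
  exact this

theorem IsQAtom.smul {A : Set X} (hA : IsQAtom π A) (g : H) :
    IsQAtom π ((fun x => g⁻¹ • x) ⁻¹' A) := by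
  obtain ⟨⟨x, hx⟩, hA', hmin⟩ := hA
  refine ⟨⟨g • x, by simpa using hx⟩, hA'.smul g, fun B hB hne => ?_⟩
  obtain ⟨y, hyA, hyB⟩ := hne
  have h1 := hmin _ (hB.smul g⁻¹) ⟨g⁻¹ • y, hyA, by simpa using hyB⟩
  intro z hz
  simpa using h1 hz

variable [TopologicalSpace H] [TopologicalSpace X] [DiscreteTopology X] [ContinuousSMul H X]

theorem ellTwoRep_apply {G : Type u} [Group G] [TopologicalSpace G] {Z : Type v}
    [TopologicalSpace Z] [DiscreteTopology Z] [MulAction G Z] [ContinuousSMul G Z] (g : G)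
    (f : EllTwo Z) (x : Z) : ((ellTwoRep G Z).toHom g f) x = f (g⁻¹ • x) := rfl

theorem EllTwo.hasSum_sq {Z : Type*} (f : EllTwo Z) : HasSum (fun x => f x ^ 2) (‖f‖ ^ 2) := by
  have := lp.hasSum_norm (p := 2) (by norm_num) f
  simpa using this

theorem EllTwo.finite_le {Z : Type*} (f : EllTwo Z) {r : ℝ} (hr : 0 < r) :
    {x : Z | r ≤ |f x|}.Finite := by
  have h1 := (EllTwo.hasSum_sq f).summable.tendsto_cofinite_zero.eventually
    (gt_mem_nhds (show (0 : ℝ) < r ^ 2 by positivity))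
  refine (Filter.eventually_cofinite.1 h1).subset fun x hx => ?_
  rw [Set.mem_ofPred_eq] at hx ⊢
  rw [not_lt, ← sq_abs (f x)]
  exact pow_le_pow_left₀ hr.le hx 2

theorem EllTwo.abs_apply_le {Z : Type*} (f : EllTwo Z) (x : Z) : |f x| ≤ ‖f‖ :=
  lp.norm_apply_le_norm (by norm_num) f x

/-- A nonzero level set of a `Q`-point of `ℓ²(X)` is `Q`-stable. -/
theorem isQStable_level (f : (ellTwoRep H X).qPoints π) {c : ℝ} (hc : c ≠ 0) :
    IsQStable π {x : X | (f : EllTwo X) x = c} := by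
  have hT := EllTwo.finite_le (f : EllTwo X) (show 0 < |c| / 2 by positivity)
  have hA : {x : X | (f : EllTwo X) x = c}.Finite := hT.subset fun x hx => by
    rw [Set.mem_ofPred_eq] at hx ⊢
    rw [hx]
    linarith [abs_nonneg c]
  refine ⟨hA, ?_⟩
  -- `δ` separates `c` from the other values of `f`.
  obtain ⟨δ, hδ, hδc⟩ : ∃ δ : ℝ, 0 < δ ∧ ∀ x, |(f : EllTwo X) x - c| < δ → (f : EllTwo X) x = c := by
    have h1 : ∀ᶠ δ : ℝ in 𝓝[>] 0, ∀ x ∈ {x : X | |c| / 2 ≤ |(f : EllTwo X) x|},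
        (f : EllTwo X) x ≠ c → δ < |(f : EllTwo X) x - c| := by
      rw [eventually_all_finite hT]
      intro x _
      by_cases hx : (f : EllTwo X) x = c
      · simp [hx]
      · filter_upwards [nhdsWithin_le_nhds (gt_mem_nhds (abs_pos.2 (sub_ne_zero.2 hx)))] with δ hδ _
        exact hδ
    have h2 : ∀ᶠ δ : ℝ in 𝓝[>] 0, δ < |c| / 2 :=
      nhdsWithin_le_nhds (gt_mem_nhds (show 0 < |c| / 2 by positivity))
    obtain ⟨δ, h1, h2, h3⟩ := (h1.and (h2.and self_mem_nhdsWithin)).exists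
    refine ⟨δ, h3, fun x hx => ?_⟩
    by_contra hne
    refine absurd (h1 x ?_ hne) (not_lt.2 hx.le)
    rw [Set.mem_ofPred_eq]
    have h4 := abs_sub_abs_le_abs_sub c ((f : EllTwo X) x)
    rw [abs_sub_comm] at h4
    linarith
  have hf := (mem_qPoints _ π _).1 f.2 (δ / 2) (by positivity)
  rw [← eventually_comap] at hf
  filter_upwards [hf] with h hh x
  have h1 : |(f : EllTwo X) (h • x) - (f : EllTwo X) x| < δ := by
    have h2 := EllTwo.abs_apply_le ((f : EllTwo X) - (ellTwoRep H X).toHom h f) (h • x)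
    rw [lp.coeFn_sub, Pi.sub_apply, ellTwoRep_apply, inv_smul_smul, ← dist_eq_norm] at h2
    linarith
  constructor
  · intro hx
    have hx' : (f : EllTwo X) (h • x) = c := hx
    rw [hx', abs_sub_comm] at h1
    exact hδc x h1
  · intro hx
    have hx' : (f : EllTwo X) x = c := hx
    rw [hx'] at h1
    exact hδc _ h1

/-- The normalized indicator functions of the atoms. -/
def atomVectors (π : H →* Q) (X : Type u) [MulAction H X] [TopologicalSpace X]
    [DiscreteTopology X] [ContinuousSMul H X] : Set ((ellTwoRep H X).qPoints π) :=
  {f | IsQAtom π {x : X | (f : EllTwo X) x ≠ 0} ∧ ‖f‖ = 1 ∧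
    ∃ c : ℝ, 0 < c ∧ ∀ x, (f : EllTwo X) x ≠ 0 → (f : EllTwo X) x = c}

/-- Atom vectors whose supports meet coincide. -/
theorem atomVectors_eq {f g : (ellTwoRep H X).qPoints π} (hf : f ∈ atomVectors π X)
    (hg : g ∈ atomVectors π X) {x : X} (hfx : (f : EllTwo X) x ≠ 0) (hgx : (g : EllTwo X) x ≠ 0) :
    f = g := by
  obtain ⟨hfA, hf1, c, hc, hfc⟩ := hf
  obtain ⟨hgA, hg1, d, hd, hgd⟩ := hg
  have hsupp := hfA.eq_of_mem hgA hfx hgx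
  have h1 : f = (c / d) • g := by
    refine Subtype.ext (lp.ext (funext fun y => ?_))
    change (f : EllTwo X) y = (c / d) * (g : EllTwo X) y
    by_cases hy : (f : EllTwo X) y = 0
    · have : (g : EllTwo X) y = 0 := by
        by_contra h
        have : y ∈ {x : X | (g : EllTwo X) x ≠ 0} := h
        rw [← hsupp] at this
        exact this hy
      rw [hy, this, mul_zero]
    · have : y ∈ {x : X | (f : EllTwo X) x ≠ 0} := hy
      rw [hsupp] at this
      rw [hfc y hy, hgd y this]
      field_simp
  have h2 : c / d = 1 := by
    have h3 := hf1
    rw [h1, norm_smul, hg1, mul_one, Real.norm_of_nonneg (by positivity)] at h3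
    exact h3
  rw [h1, h2, one_smul]

theorem EllTwo.inner_eq_tsum {Z : Type*} (f g : EllTwo Z) :
    inner ℝ f g = ∑' x, f x * g x := by
  rw [lp.inner_eq_tsum]
  exact tsum_congr fun x => by simp [mul_comm]

theorem orthonormal_atomVectors :
    Orthonormal ℝ ((↑) : atomVectors π X → (ellTwoRep H X).qPoints π) := by
  refine ⟨fun f => f.2.2.1, fun f g hfg => ?_⟩
  change inner ℝ ((f : (ellTwoRep H X).qPoints π) : EllTwo X)
    ((g : (ellTwoRep H X).qPoints π) : EllTwo X) = 0
  rw [EllTwo.inner_eq_tsum]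
  refine (tsum_congr fun x => ?_).trans tsum_zero
  by_contra h
  exact hfg (Subtype.ext (atomVectors_eq f.2 g.2 (left_ne_zero_of_mul h) (right_ne_zero_of_mul h)))

/-- Since distinct orthonormal vectors are far apart, the set of atom vectors is closed, and its
invariance under the dense image of `H` gives invariance under `Q`. -/
theorem atomVectors_invariant (hπ : DenseRange π) (q : Q) :
    ∀ f ∈ atomVectors π X, ((ellTwoRep H X).qRep π hπ).toHom q f ∈ atomVectors π X := by
  intro f hf
  have hclosed : IsClosed {q : Q | ((ellTwoRep H X).qRep π hπ).toHom q f ∈ atomVectors π X} :=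
    orthonormal_atomVectors.isClosed.preimage (((ellTwoRep H X).qRep π hπ).continuous_orbit f)
  refine hπ.induction_on (p := fun q => ((ellTwoRep H X).qRep π hπ).toHom q f ∈ atomVectors π X)
    q hclosed fun h => ?_
  obtain ⟨hA, h1, c, hc, hfc⟩ := hf
  have hval : ∀ x, (((ellTwoRep H X).qRep π hπ).toHom (π h) f : EllTwo X) x =
      (f : EllTwo X) (h⁻¹ • x) := fun x => by
    rw [qRep_apply]
    rfl
  refine ⟨?_, ?_, c, hc, fun x => ?_⟩
  · simp only [hval]
    exact hA.smul h
  · rw [LinearIsometryEquiv.norm_map, h1]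
  · rw [hval]
    exact hfc _

/-- Every atom carries an atom vector. Pairing with it is, up to a positive factor, summation over the
atom. -/
theorem exists_atomVector {A : Set X} (hA : IsQAtom π A) :
    ∃ f ∈ atomVectors π X, ∃ c : ℝ, 0 < c ∧
      ∀ g : EllTwo X, inner ℝ (f : EllTwo X) g = c * ∑ x ∈ hA.finite.toFinset, g x := by
  classical
  set v : EllTwo X := ∑ x ∈ hA.finite.toFinset, lp.single 2 x (1 : ℝ) with hv
  have hvx : ∀ x, v x = if x ∈ A then 1 else 0 := by
    intro x
    rw [hv, lp.coeFn_sum, Finset.sum_apply]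
    simp [lp.single_apply, Pi.single_apply]
  have hv0 : v ≠ 0 := by
    obtain ⟨x, hx⟩ := hA.1
    intro h0
    have := hvx x
    rw [h0, if_pos hx] at this
    simp at this
  have hvQ : v ∈ (ellTwoRep H X).qPoints π := by
    rw [mem_qPoints]
    intro ε hε
    rw [← eventually_comap]
    filter_upwards [hA.2.1.2] with h hh
    have : (ellTwoRep H X).toHom h v = v := by
      refine lp.ext (funext fun x => ?_)
      rw [ellTwoRep_apply, hvx, hvx]
      have := hh (h⁻¹ • x)
      rw [smul_inv_smul] at this
      simp [this]
    rw [this, dist_self]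
    exact hε.le
  have hnv : 0 < ‖v‖ := norm_pos_iff.2 hv0
  have hfx : ∀ x, ((‖v‖⁻¹ • v : EllTwo X)) x = if x ∈ A then ‖v‖⁻¹ else 0 := by
    intro x
    rw [lp.coeFn_smul, Pi.smul_apply, hvx]
    simp
  refine ⟨‖v‖⁻¹ • ⟨v, hvQ⟩, ⟨?_, ?_, ‖v‖⁻¹, by positivity, fun x => ?_⟩, ‖v‖⁻¹, by positivity,
    fun g => ?_⟩
  · have : {x : X | ((‖v‖⁻¹ • (⟨v, hvQ⟩ : (ellTwoRep H X).qPoints π) :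
        (ellTwoRep H X).qPoints π) : EllTwo X) x ≠ 0} = A := by
      ext x
      rw [Set.mem_ofPred_eq, Submodule.coe_smul, hfx]
      simp [hnv.ne']
    rw [this]
    exact hA
  · rw [norm_smul, norm_inv, norm_norm]
    exact inv_mul_cancel₀ hnv.ne'
  · rw [Submodule.coe_smul, hfx]
    split_ifs <;> simp
  · rw [Submodule.coe_smul, inner_smul_left, conj_trivial]
    congr 1
    change inner ℝ v g = _
    rw [hv, sum_inner]
    refine Finset.sum_congr rfl fun x _ => ?_
    rw [EllTwo.inner_eq_tsum, tsum_eq_single x]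
    · simp
    · intro y hy
      simp [lp.single_apply, hy]

/-- A nonzero value of a `Q`-point `f` is taken on a `Q`-stable level set. This set contains an atom, on
which `f` is a nonzero constant. -/
theorem atomVectors_total (f : (ellTwoRep H X).qPoints π)
    (hf : ∀ s ∈ atomVectors π X, inner ℝ s f = 0) : f = 0 := by
  refine Subtype.ext (lp.ext (funext fun x => ?_))
  by_contra hx
  obtain ⟨A, hAf, hxA, hA⟩ := (isQStable_level f hx).exists_atom (x := x) rfl
  obtain ⟨e, he, c, hc, hec⟩ := exists_atomVector hA
  have h1 : inner ℝ (e : EllTwo X) (f : EllTwo X) = 0 := hf e he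
  have h3 : ∀ y ∈ hA.finite.toFinset, (f : EllTwo X) y = (f : EllTwo X) x :=
    fun y hy => hAf ((Set.Finite.mem_toFinset _).1 hy)
  rw [hec, Finset.sum_congr rfl h3, Finset.sum_const, nsmul_eq_mul] at h1
  have h2 : (hA.finite.toFinset.card : ℝ) ≠ 0 := by
    rw [Nat.cast_ne_zero]
    exact Finset.card_ne_zero_of_mem ((Set.Finite.mem_toFinset _).2 hxA)
  exact mul_ne_zero hc.ne' (mul_ne_zero h2 hx) h1

/-- The `Q`-points of `ℓ²(X)` form the permutation representation `ℓ²(Y)` of a continuous discrete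
`Q`-set `Y`, the set of atoms; `A y` is the finite subset of `X` underlying the atom `y`. -/
theorem exists_qPoints_equiv_ellTwo (X : Type u) [MulAction H X] [TopologicalSpace X]
    [DiscreteTopology X] [ContinuousSMul H X] (hπ : DenseRange π) :
    ∃ (Y : Type u) (_ : TopologicalSpace Y) (_ : DiscreteTopology Y) (_ : MulAction Q Y)
      (_ : ContinuousSMul Q Y) (T : (ellTwoRep H X).qPoints π ≃ₗᵢ[ℝ] EllTwo Y) (A : Y → Set X),
      (∀ (q : Q) (f : (ellTwoRep H X).qPoints π),
        T (((ellTwoRep H X).qRep π hπ).toHom q f) = (ellTwoRep Q Y).toHom q (T f)) ∧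
      (∀ y, IsQAtom π (A y)) ∧ (∀ (h : H) (y : Y) (x : X), x ∈ A (π h • y) ↔ h⁻¹ • x ∈ A y) ∧
      ∀ (y y' : Y) (x : X), x ∈ A y → x ∈ A y' → y = y' := by
  have : CompleteSpace ((ellTwoRep H X).qPoints π) :=
    ((ellTwoRep H X).isClosed_qPoints π).completeSpace_coe
  obtain ⟨hc, T, hT⟩ := ((ellTwoRep H X).qRep π hπ).exists_equiv_ellTwo (atomVectors π X)
    orthonormal_atomVectors (atomVectors_invariant hπ) atomVectors_total
  let act := ((ellTwoRep H X).qRep π hπ).actionOn (atomVectors π X) (atomVectors_invariant hπ)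
  refine ⟨atomVectors π X, inferInstance, orthonormal_atomVectors.discreteTopology, act, hc, T,
    fun y => {x : X | ((y : (ellTwoRep H X).qPoints π) : EllTwo X) x ≠ 0}, hT, fun y => y.2.1,
    fun h y x => ?_, fun y y' x hx hx' => Subtype.ext (atomVectors_eq y.2 y'.2 hx hx')⟩
  change (((ellTwoRep H X).qRep π hπ).toHom (π h) y : EllTwo X) x ≠ 0 ↔ _
  rw [qRep_apply]
  rfl

end Atoms

/-! ### Means and almost invariant vectors -/

section MeanOfVectors

variable {Y : Type v} [TopologicalSpace Y]

/-- Multiplication by a bounded function on `ℓ²(Y)`. -/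
noncomputable def EllTwo.mul (F : Y →ᵇ ℝ) (v : EllTwo Y) : EllTwo Y :=
  ⟨fun y => F y * v y, by
    change Memℓp _ _
    refine memℓp_gen ?_
    have h1 := (EllTwo.hasSum_sq v).summable.mul_left (‖F‖ ^ 2)
    refine h1.of_nonneg_of_le (fun y => by positivity) fun y => ?_
    have h2 := pow_le_pow_left₀ (norm_nonneg _) (F.norm_coe_le_norm y) 2
    simp only [ENNReal.toReal_ofNat, Real.rpow_two, norm_mul, mul_pow, Real.norm_eq_abs, sq_abs]
    rw [Real.norm_eq_abs, sq_abs] at h2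
    exact mul_le_mul_of_nonneg_right h2 (sq_nonneg _)⟩

theorem EllTwo.mul_apply (F : Y →ᵇ ℝ) (v : EllTwo Y) (y : Y) : EllTwo.mul F v y = F y * v y := rfl

theorem EllTwo.norm_mul_le (F : Y →ᵇ ℝ) (v : EllTwo Y) : ‖EllTwo.mul F v‖ ≤ ‖F‖ * ‖v‖ := by
  refine (sq_le_sq₀ (norm_nonneg _) (by positivity)).1 ?_
  rw [mul_pow]
  refine hasSum_le (fun y => ?_) (EllTwo.hasSum_sq (EllTwo.mul F v))
    ((EllTwo.hasSum_sq v).mul_left (‖F‖ ^ 2))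
  have h2 := pow_le_pow_left₀ (norm_nonneg _) (F.norm_coe_le_norm y) 2
  rw [Real.norm_eq_abs, sq_abs] at h2
  rw [EllTwo.mul_apply, mul_pow]
  exact mul_le_mul_of_nonneg_right h2 (sq_nonneg _)

/-- The functional `F ↦ ∑ F(y) v(y)²`. -/
noncomputable def EllTwo.state (v : EllTwo Y) : (Y →ᵇ ℝ) →ₗ[ℝ] ℝ where
  toFun F := inner ℝ (EllTwo.mul F v) v
  map_add' F F' := by
    rw [← inner_add_left]
    congr 1
    exact lp.ext (funext fun y => add_mul _ _ _)
  map_smul' r F := by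
    rw [RingHom.id_apply, smul_eq_mul, ← real_inner_smul_left]
    congr 1
    exact lp.ext (funext fun y => mul_assoc _ _ _)

theorem EllTwo.state_apply (v : EllTwo Y) (F : Y →ᵇ ℝ) :
    EllTwo.state v F = inner ℝ (EllTwo.mul F v) v := rfl

theorem EllTwo.state_eq_tsum (v : EllTwo Y) (F : Y →ᵇ ℝ) :
    EllTwo.state v F = ∑' y, F y * v y ^ 2 := by
  rw [EllTwo.state_apply, EllTwo.inner_eq_tsum]
  exact tsum_congr fun y => by rw [EllTwo.mul_apply, mul_assoc, sq]

theorem EllTwo.abs_state_le (v : EllTwo Y) (F : Y →ᵇ ℝ) : |EllTwo.state v F| ≤ ‖F‖ * ‖v‖ ^ 2 := by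
  refine (abs_real_inner_le_norm (EllTwo.mul F v) v).trans ?_
  rw [sq, ← mul_assoc]
  exact mul_le_mul_of_nonneg_right (EllTwo.norm_mul_le F v) (norm_nonneg _)

theorem EllTwo.abs_state_sub_le (v w : EllTwo Y) (F : Y →ᵇ ℝ) :
    |EllTwo.state w F - EllTwo.state v F| ≤ ‖F‖ * ‖v - w‖ * (‖v‖ + ‖w‖) := by
  have h1 : EllTwo.mul F w - EllTwo.mul F v = EllTwo.mul F (w - v) :=
    lp.ext (funext fun y => (mul_sub _ _ _).symm)
  have h2 : EllTwo.state w F - EllTwo.state v F =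
      inner ℝ (EllTwo.mul F (w - v)) w + inner ℝ (EllTwo.mul F v) (w - v) := by
    rw [EllTwo.state_apply, EllTwo.state_apply, ← h1, inner_sub_left, inner_sub_right]
    ring
  rw [h2]
  refine (abs_add_le _ _).trans ?_
  have h3 := abs_real_inner_le_norm (EllTwo.mul F (w - v)) w
  have h4 := abs_real_inner_le_norm (EllTwo.mul F v) (w - v)
  have h5 := mul_le_mul_of_nonneg_right (EllTwo.norm_mul_le F (w - v)) (norm_nonneg w)
  have h6 := mul_le_mul_of_nonneg_right (EllTwo.norm_mul_le F v) (norm_nonneg (w - v))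
  rw [norm_sub_rev v w]
  linarith

end MeanOfVectors

/-- Limits of the functionals `F ↦ ∑ F(y) f(y)²` along almost invariant unit vectors `f` are
invariant means. -/
theorem OrthRep.AlmostHasInvariantVectors.eymardAmenable {G : Type u} [Group G] [TopologicalSpace G]
    {Y : Type v} [TopologicalSpace Y] [DiscreteTopology Y] [MulAction G Y] [ContinuousSMul G Y]
    (h : (ellTwoRep G Y).AlmostHasInvariantVectors) : EymardAmenable G Y := by
  classical
  choose f hf1 hf using fun i : Finset G × ℕ =>
    h i.1 i.1.finite_toSet.isCompact (((i.2 : ℝ) + 1)⁻¹) (by positivity)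
  let U : Ultrafilter (Finset G × ℕ) := Ultrafilter.of atTop
  have hU : (U : Filter (Finset G × ℕ)) ≤ atTop := Ultrafilter.of_le atTop
  have hlim : ∀ F : Y →ᵇ ℝ, ∃ a, Tendsto (fun i => EllTwo.state (f i) F) U (𝓝 a) := by
    intro F
    obtain ⟨a, -, ha⟩ := (isCompact_Icc (a := -‖F‖) (b := ‖F‖)).ultrafilter_le_nhds
      (U.map fun i => EllTwo.state (f i) F) (by
        rw [le_principal_iff]
        refine Ultrafilter.mem_map.2 (univ_mem' fun i => ?_)
        have := EllTwo.abs_state_le (f i) F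
        rw [hf1, one_pow, mul_one] at this
        exact abs_le.1 this)
    exact ⟨a, ha⟩
  choose m hm using hlim
  refine ⟨{ toFun := m, map_add' := fun F F' => ?_, map_smul' := fun r F => ?_ }, fun F hF => ?_, ?_,
    fun g F => ?_⟩
  · refine tendsto_nhds_unique (hm _) ?_
    simpa only [map_add] using (hm F).add (hm F')
  · refine tendsto_nhds_unique (hm _) ?_
    simpa only [map_smul, RingHom.id_apply] using (hm F).const_smul r
  · refine ge_of_tendsto' (hm F) fun i => ?_
    rw [EllTwo.state_eq_tsum]
    exact tsum_nonneg fun y => mul_nonneg (hF y) (sq_nonneg _)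
  · refine tendsto_nhds_unique (hm 1) ?_
    refine tendsto_const_nhds.congr fun i => ?_
    rw [EllTwo.state_eq_tsum]
    simp [(EllTwo.hasSum_sq (f i)).tsum_eq, hf1]
  · refine tendsto_nhds_unique (hm _) ?_
    have h1 : ∀ i, EllTwo.state (f i)
        (F.compContinuous ⟨fun y : Y => g • y, continuous_of_discreteTopology⟩) =
        EllTwo.state ((ellTwoRep G Y).toHom g (f i)) F := by
      intro i
      rw [EllTwo.state_eq_tsum, EllTwo.state_eq_tsum]
      refine Eq.trans (tsum_congr fun y => ?_) ((MulAction.toPerm g).tsum_eq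
        fun y => F y * ((ellTwoRep G Y).toHom g (f i)) y ^ 2)
      rw [ellTwoRep_apply, MulAction.toPerm_apply, inv_smul_smul]
      rfl
    simp_rw [h1]
    have h2 : Tendsto (fun i => EllTwo.state ((ellTwoRep G Y).toHom g (f i)) F -
        EllTwo.state (f i) F) U (𝓝 0) := by
      have h3 : Tendsto (fun i : Finset G × ℕ => ‖F‖ * ((i.2 : ℝ) + 1)⁻¹ * 2) U (𝓝 0) := by
        have h4 : Tendsto (fun i : Finset G × ℕ => i.2) atTop atTop := by
          rw [← prod_atTop_atTop_eq]
          exact tendsto_snd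
        have h5 := (tendsto_one_div_add_atTop_nhds_zero_nat (𝕜 := ℝ)).comp (h4.mono_left hU)
        simpa [Function.comp_def] using (h5.const_mul ‖F‖).mul_const 2
      refine squeeze_zero_norm' ?_ h3
      filter_upwards [hU (eventually_ge_atTop (({g} : Finset G), 0))] with i hi
      rw [Real.norm_eq_abs]
      refine (EllTwo.abs_state_sub_le _ _ _).trans ?_
      rw [LinearIsometryEquiv.norm_map, hf1, one_add_one_eq_two]
      have h6 := hf i g (by simpa using hi.1)
      gcongr
    simpa using h2.add (hm F)

/-! ### Reduced cohomology of the target of a Kazhdan homomorphism -/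

/-- The indicator function of a subgroup `M` is a coefficient of the representation on `ℓ²(G ⧸ M)`. -/
theorem posSemidef_subgroup_indicator {G : Type u} [Group G] (M : Subgroup G)
    [DecidablePred (· ∈ M)] :
    (Matrix.of fun g h : G => if g⁻¹ * h ∈ M then (1 : ℝ) else 0).PosSemidef := by
  classical
  have h1 := posSemidef_inner fun g : G => (lp.single 2 (g : G ⧸ M) (1 : ℝ) : EllTwo (G ⧸ M))
  refine (congrArg Matrix.PosSemidef ?_).mp h1
  ext g h
  rw [Matrix.of_apply, Matrix.of_apply, EllTwo.inner_eq_tsum, tsum_eq_single (h : G ⧸ M)]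
  · by_cases hgh : g⁻¹ * h ∈ M
    · have : (g : G ⧸ M) = h := QuotientGroup.eq.2 hgh
      simp [this, hgh]
    · have : (h : G ⧸ M) ≠ g := fun h' => hgh (QuotientGroup.eq.1 h'.symm)
      simp [lp.single_apply, this, hgh]
  · intro x hx
    simp [lp.single_apply, hx]

section Interior

variable {H Q : Type*} [Group H] [Group Q] [TopologicalSpace Q] [IsTopologicalGroup Q] {π : H →* Q}

/-- If finitely many translates of a closed set `A ⊆ Q` cover the image of `π⁻¹(W)` for some
neighbourhood `W` of `1`, they cover `W`, so that `A` has interior points by the Baire category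
theorem. -/
theorem nonempty_interior_of_eventually_translate [BaireSpace Q] (hπ : DenseRange π) {A : Set Q}
    (hA : IsClosed A) (s : Finset H) (g₀ : H)
    (hev : ∀ᶠ h in comap π (𝓝 1), ∃ g ∈ s, π (g * h * g₀) ∈ A) : (interior A).Nonempty := by
  rw [eventually_comap, eventually_nhds_iff] at hev
  obtain ⟨W, hW, hWo, hW1⟩ := hev
  let φ : H → Q ≃ₜ Q := fun g => (Homeomorph.mulLeft (π g)).trans (Homeomorph.mulRight (π g₀))
  have hφ : ∀ g q, φ g q = π g * q * π g₀ := fun _ _ => rfl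
  let f : Option s → Set Q := fun i => i.elim Wᶜ fun g => φ g ⁻¹' A
  have hfc : ∀ i, IsClosed (f i) := by
    rintro (_ | g)
    · exact hWo.isClosed_compl
    · exact hA.preimage (φ g).continuous
  have hfu : ⋃ i, f i = Set.univ := by
    have hclosed : IsClosed (⋃ i, f i) := isClosed_iUnion_of_finite hfc
    refine Set.eq_univ_of_univ_subset ?_
    rw [← hπ.closure_range]
    refine hclosed.closure_subset_iff.2 ?_
    rintro _ ⟨h, rfl⟩
    by_cases hh : π h ∈ W
    · obtain ⟨g, hg, hgA⟩ := hW _ hh h rfl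
      refine Set.mem_iUnion.2 ⟨some ⟨g, hg⟩, ?_⟩
      change φ g (π h) ∈ A
      simpa [hφ] using hgA
    · exact Set.mem_iUnion.2 ⟨none, hh⟩
  obtain ⟨q, hqW, hq⟩ := (dense_iUnion_interior_of_closed hfc hfu).inter_open_nonempty W hWo ⟨1, hW1⟩
  obtain ⟨i, hi⟩ := Set.mem_iUnion.1 hq
  match i, hi with
  | none, hi => exact absurd hqW (interior_subset hi)
  | some g, hi =>
    change q ∈ interior (φ g ⁻¹' A) at hi
    rw [← (φ g).preimage_interior] at hi
    exact ⟨_, hi⟩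

end Interior

section Reduced

open OrthRep

variable {H Q : Type u} [Group H] [TopologicalSpace H] [IsTopologicalGroup H]
  [Group Q] [TopologicalSpace Q] [IsTopologicalGroup Q] [LocallyCompactSpace Q]
  {π : H →* Q} {hπ : DenseRange π}

/-- Some compactly generated open subgroup `M` of `H` has image with open closure in `Q`: the
indicator functions of such subgroups `M` approximate `1` uniformly on compact sets, because every
compact set is contained in one of them. -/
theorem IsKazhdanHom.exists_isOpen_closure_map [LocallyCompactSpace H] (hK : IsKazhdanHom π hπ) :
    ∃ V : Set H, IsCompact V ∧ V ∈ 𝓝 1 ∧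
      IsOpen (((Subgroup.closure V).map π).topologicalClosure : Set Q) := by
  classical
  obtain ⟨K₀, hK₀, hK₀1⟩ := exists_compact_mem_nhds (1 : H)
  have hmem : ∀ V : {V : Set H // IsCompact V ∧ V ∈ 𝓝 1}, ∀ᶠ g in 𝓝 (1 : H),
      g ∈ Subgroup.closure V.1 := fun V => by
    filter_upwards [V.2.2] with g hg using Subgroup.subset_closure hg
  obtain ⟨V, c, hc, s, g₀, hev⟩ := hK.exists_le_of_approx_one
    (I := {V : Set H // IsCompact V ∧ V ∈ 𝓝 1})
    (fun V g => if g ∈ Subgroup.closure V.1 then 1 else 0)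
    (fun V => posSemidef_subgroup_indicator _) (fun V => by simp [one_mem])
    (fun V g => by positivity)
    (fun V => by
      refine (continuousAt_const (y := (1 : ℝ))).congr ?_
      filter_upwards [hmem V] with g hg
      rw [if_pos hg])
    (fun K hKc ε hε => by
      refine ⟨⟨K ∪ K₀, hKc.union hK₀, mem_of_superset hK₀1 Set.subset_union_right⟩, fun g hg => ?_⟩
      have hmem' : g ∈ Subgroup.closure (K ∪ K₀) := Subgroup.subset_closure (Or.inl hg)
      dsimp only
      rw [if_pos hmem']
      linarith)
  refine ⟨V.1, V.2.1, V.2.2, ?_⟩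
  obtain ⟨q, hq⟩ := nonempty_interior_of_eventually_translate hπ
    (((Subgroup.closure V.1).map π).isClosed_topologicalClosure) s g₀ (by
      filter_upwards [hev] with h hh
      obtain ⟨g, hg, hgc⟩ := hh
      refine ⟨g, hg, Subgroup.le_topologicalClosure _ ?_⟩
      refine ⟨_, ?_, rfl⟩
      by_contra hcon
      rw [SetLike.mem_coe] at hcon
      rw [if_neg hcon] at hgc
      linarith)
  exact Subgroup.isOpen_of_mem_nhds _ (mem_interior_iff_mem_nhds.1 hq)

variable {E : Type u} [NormedAddCommGroup E] [InnerProductSpace ℝ E] {ρ : OrthRep Q E}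

theorem OrthRep.Z1.norm_apply_mul_le {G : Type*} [Group G] [TopologicalSpace G] {ρ : OrthRep G E}
    (b : ρ.Z1) (g h : G) : ‖b.1 (g * h)‖ ≤ ‖b.1 h‖ + ‖b.1 g‖ := by
  rw [Z1.map_mul]
  refine (norm_add_le _ _).trans ?_
  rw [LinearIsometryEquiv.norm_map]

theorem OrthRep.Z1.norm_apply_le {G : Type*} [Group G] [TopologicalSpace G] {ρ : OrthRep G E}
    (b : ρ.Z1) (g h : G) : ‖b.1 h‖ ≤ ‖b.1 (g * h)‖ + ‖b.1 g‖ := by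
  have h1 : ‖b.1 h‖ = ‖b.1 (g * h) - b.1 g‖ := by
    rw [Z1.map_mul, add_sub_cancel_right, LinearIsometryEquiv.norm_map]
  rw [h1]
  exact norm_sub_le _ _

theorem OrthRep.Z1.norm_apply_inv {G : Type*} [Group G] [TopologicalSpace G] {ρ : OrthRep G E}
    (b : ρ.Z1) (g : G) : ‖b.1 g⁻¹‖ = ‖b.1 g‖ := by
  have := Z1.dist_eq b g 1
  rw [Z1.map_one, sub_zero, mul_one] at this
  exact this.symm

/-- Let `V` be a compact neighbourhood of `1` in `H`. If a cocycle `b` of `Q` is, on `H`, a limit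
of coboundaries uniformly on compact sets, then there is a sequence of coboundaries converging to
`b` pointwise on `V`, and uniformly on a neighbourhood of `1` in `Q`.

The proof considers all sequences for which the rate on `V` is geometric, and the functions of positive
type `exp (-∑ 2ⁿ ‖b - ∂ξₙ‖²)`, which approximate `1`. Where such a function is bounded below, the
convergence is uniform. -/
theorem IsKazhdanHom.exists_seq_coboundary (hK : IsKazhdanHom π hπ) (hcont : Continuous π)
    (b : ρ.Z1)
    (hb : ∀ K : Set H, IsCompact K → ∀ ε : ℝ, 0 < ε →
      ∃ ξ : E, ∀ h ∈ K, ‖(b - ρ.coboundary ξ).1 (π h)‖ ≤ ε)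
    {V : Set H} (hV : IsCompact V) (hV1 : V ∈ 𝓝 1) :
    ∃ ξ : ℕ → E, (∀ h ∈ V, Tendsto (fun n => (b - ρ.coboundary (ξ n)).1 (π h)) atTop (𝓝 0)) ∧
      ∃ W ∈ 𝓝 (1 : Q), ∀ ε : ℝ, 0 < ε → ∀ᶠ n in atTop, ∀ q ∈ W,
        ‖(b - ρ.coboundary (ξ n)).1 q‖ ≤ ε := by
  let D : E → Q → E := fun ξ q => (b - ρ.coboundary ξ).1 q
  have hDcont : ∀ ξ, Continuous (D ξ) := fun ξ => (b - ρ.coboundary ξ).1.continuous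
  let I := {ξ : ℕ → E // ∀ n, ∀ h ∈ V, ‖D (ξ n) (π h)‖ ≤ (1 / 2) ^ n}
  let S : I → ℕ → H → ℝ := fun ξ N h => ∑ n ∈ Finset.range N, 2 ^ n * ‖D (ξ.1 n) (π h)‖ ^ 2
  have hSmono : ∀ ξ h, Monotone fun N => S ξ N h := fun ξ h =>
    monotone_nat_of_le_succ fun N => by
      change S ξ N h ≤ S ξ (N + 1) h
      simp only [S, Finset.sum_range_succ]
      have : 0 ≤ 2 ^ N * ‖D (ξ.1 N) (π h)‖ ^ 2 := by positivity
      linarith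
  have hbdd : ∀ ξ h, BddBelow (Set.range fun N => Real.exp (-S ξ N h)) := fun ξ h =>
    ⟨0, by rintro _ ⟨N, rfl⟩; exact (Real.exp_pos _).le⟩
  -- If the series `∑ 2 ^ n ‖D (ξ n) (π h)‖²` diverges, then `φ ξ h = 0`.
  let φ : I → H → ℝ := fun ξ h => ⨅ N, Real.exp (-S ξ N h)
  have hφlim : ∀ ξ h, Tendsto (fun N => Real.exp (-S ξ N h)) atTop (𝓝 (φ ξ h)) := fun ξ h =>
    tendsto_atTop_ciInf (fun N N' hN => Real.exp_le_exp.2 (neg_le_neg (hSmono ξ h hN))) (hbdd ξ h)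
  have hgeom : ∀ n : ℕ, ∀ δ x : ℝ, 0 ≤ x → x ≤ δ * (1 / 2) ^ n →
      2 ^ n * x ^ 2 ≤ δ ^ 2 * (1 / 2) ^ n := by
    intro n δ x hx hxn
    calc 2 ^ n * x ^ 2 ≤ 2 ^ n * (δ * (1 / 2) ^ n) ^ 2 := by gcongr
      _ = δ ^ 2 * (1 / 2) ^ n * (2 ^ n * (1 / 2) ^ n) := by ring
      _ = δ ^ 2 * (1 / 2) ^ n := by rw [← mul_pow]; norm_num
  obtain ⟨ξ, c, hc, s, g₀, hev⟩ := hK.exists_le_of_approx_one (I := I) φ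
    (fun ξ => by
      refine posSemidef_of_tendsto
        (posSemidef_exp_neg_sum (fun n h => D (ξ.1 n) (π h)) (w := fun n => 2 ^ n)
          fun n => by positivity) fun g h => ?_
      refine (hφlim ξ (g⁻¹ * h)).congr fun N => ?_
      simp only [Matrix.of_apply, S]
      congr 2
      refine Finset.sum_congr rfl fun n _ => ?_
      rw [_root_.map_mul, map_inv]
      congr 2
      exact (Z1.dist_eq (b - ρ.coboundary (ξ.1 n)) (π g) (π h)).symm)
    (fun ξ => by
      have : ∀ N, S ξ N 1 = 0 := fun N => by
        refine Finset.sum_eq_zero fun n _ => ?_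
        have : D (ξ.1 n) (π 1) = 0 := by
          rw [_root_.map_one]
          exact Z1.map_one _
        rw [this]
        simp
      simp [φ, this])
    (fun ξ g => Real.iInf_nonneg fun N => (Real.exp_pos _).le)
    (fun ξ => by
      have hle : ∀ n, ∀ h ∈ V, ‖2 ^ n * ‖D (ξ.1 n) (π h)‖ ^ 2‖ ≤ (1 / 2 : ℝ) ^ n := by
        intro n h hh
        rw [Real.norm_of_nonneg (by positivity)]
        simpa using hgeom n 1 _ (norm_nonneg _) (by simpa using ξ.2 n h hh)
      have h1 : ContinuousOn (fun h => ∑' n, 2 ^ n * ‖D (ξ.1 n) (π h)‖ ^ 2) V :=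
        continuousOn_tsum (fun n => (((hDcont _).comp hcont).norm.pow 2).const_mul _ |>.continuousOn)
          summable_geometric_two hle
      have h2 : ∀ h ∈ V, φ ξ h = Real.exp (-∑' n, 2 ^ n * ‖D (ξ.1 n) (π h)‖ ^ 2) := by
        intro h hh
        refine tendsto_nhds_unique (hφlim ξ h) ?_
        have : Summable fun n => 2 ^ n * ‖D (ξ.1 n) (π h)‖ ^ 2 :=
          summable_geometric_two.of_norm_bounded fun n => hle n h hh
        exact (Real.continuous_exp.tendsto _).comp this.hasSum.tendsto_sum_nat.neg
      refine (h1.continuousAt hV1).neg.rexp.congr ?_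
      filter_upwards [hV1] with h hh
      exact (h2 h hh).symm)
    (fun K hKc ε hε => by
      set δ : ℝ := min 1 (ε / 2) with hδ
      have hδ0 : 0 < δ := by positivity
      have hδ1 : δ ≤ 1 := min_le_left _ _
      have hδε : δ ≤ ε / 2 := min_le_right _ _
      choose ξ hξ using fun n : ℕ => hb (K ∪ V) (hKc.union hV) (δ * (1 / 2) ^ n) (by positivity)
      refine ⟨⟨ξ, fun n h hh => (hξ n h (Or.inr hh)).trans ?_⟩, fun g hg => le_ciInf fun N => ?_⟩
      · exact mul_le_of_le_one_left (by positivity) hδ1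
      · refine le_trans ?_ (Real.one_sub_le_exp_neg _)
        have h1 : ∑ n ∈ Finset.range N, 2 ^ n * ‖D (ξ n) (π g)‖ ^ 2 ≤
            ∑ n ∈ Finset.range N, δ ^ 2 * (1 / 2) ^ n :=
          Finset.sum_le_sum fun n _ => hgeom n δ _ (norm_nonneg _) (hξ n g (Or.inl hg))
        rw [← Finset.mul_sum] at h1
        have h2 := sum_geometric_two_le N
        have h3 : δ ^ 2 * ∑ n ∈ Finset.range N, (1 / 2 : ℝ) ^ n ≤ δ ^ 2 * 2 := by gcongr
        simp only [S]
        nlinarith)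
  refine ⟨ξ.1, fun h hh => ?_, ?_⟩
  · refine squeeze_zero_norm (fun n => ξ.2 n h hh) ?_
    exact tendsto_pow_atTop_nhds_zero_of_lt_one (by norm_num) (by norm_num)
  set L : ℝ := -Real.log c with hL
  let A : Set Q := {q | ∀ n, 2 ^ n * ‖D (ξ.1 n) q‖ ^ 2 ≤ L}
  have hA : IsClosed A := by
    simp only [A, Set.ofPred_forall]
    exact isClosed_iInter fun n => isClosed_le (((hDcont _).norm.pow 2).const_mul _) continuous_const
  obtain ⟨a, ha⟩ := nonempty_interior_of_eventually_translate hπ hA s g₀ (by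
    filter_upwards [hev] with h hh
    obtain ⟨g, hg, hgc⟩ := hh
    refine ⟨g, hg, fun n => ?_⟩
    have h1 := hgc.trans (ciInf_le (hbdd ξ (g * h * g₀)) (n + 1))
    rw [← Real.log_le_iff_le_exp hc] at h1
    have h2 : 2 ^ n * ‖D (ξ.1 n) (π (g * h * g₀))‖ ^ 2 ≤ S ξ (n + 1) (g * h * g₀) :=
      Finset.single_le_sum (f := fun n => 2 ^ n * ‖D (ξ.1 n) (π (g * h * g₀))‖ ^ 2)
        (fun i _ => by positivity) (Finset.self_mem_range_succ n)
    linarith)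
  have hstep : ∀ n, ∀ q ∈ A, ‖D (ξ.1 n) q‖ ≤ Real.sqrt (L * (1 / 2) ^ n) := by
    intro n q hq
    refine Real.le_sqrt_of_sq_le ?_
    have h1 := mul_le_mul_of_nonneg_left (hq n) (show (0 : ℝ) ≤ (1 / 2) ^ n by positivity)
    rw [← mul_assoc, ← mul_pow] at h1
    norm_num at h1 ⊢
    linarith
  refine ⟨(fun q => a * q) ⁻¹' A, ?_, fun ε hε => ?_⟩
  · have : Tendsto (fun q : Q => a * q) (𝓝 1) (𝓝 a) := by
      simpa using (continuous_const_mul a).tendsto 1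
    exact this (mem_interior_iff_mem_nhds.1 ha)
  · have h1 : Tendsto (fun n : ℕ => 2 * Real.sqrt (L * (1 / 2) ^ n)) atTop (𝓝 0) := by
      have h2 := ((tendsto_pow_atTop_nhds_zero_of_lt_one (r := (1 / 2 : ℝ)) (by norm_num)
        (by norm_num)).const_mul L).sqrt.const_mul 2
      simpa using h2
    filter_upwards [h1.eventually (gt_mem_nhds hε)] with n hn q hq
    have h2 := hstep n a (interior_subset ha)
    have h3 := hstep n (a * q) hq
    have h4 := Z1.norm_apply_le (b - ρ.coboundary (ξ.1 n)) a q
    change ‖D (ξ.1 n) q‖ ≤ ‖D (ξ.1 n) (a * q)‖ + ‖D (ξ.1 n) a‖ at h4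
    change ‖D (ξ.1 n) q‖ ≤ ε
    linarith

/-- A cocycle of `Q` which on `H` is a limit of coboundaries, uniformly on compact subsets of `H`,
is a limit of coboundaries uniformly on compact subsets of `Q`. -/
theorem IsKazhdanHom.exists_coboundary_of_comp [LocallyCompactSpace H] (hK : IsKazhdanHom π hπ)
    (hcont : Continuous π)
    (b : ρ.Z1)
    (hb : ∀ K : Set H, IsCompact K → ∀ ε : ℝ, 0 < ε →
      ∃ ξ : E, ∀ h ∈ K, ‖(b - ρ.coboundary ξ).1 (π h)‖ ≤ ε)
    {C : Set Q} (hC : IsCompact C) {ε : ℝ} (hε : 0 < ε) :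
    ∃ ξ : E, ∀ q ∈ C, ‖(b - ρ.coboundary ξ).1 q‖ ≤ ε := by
  obtain ⟨V, hV, hV1, hN⟩ := hK.exists_isOpen_closure_map
  set N := ((Subgroup.closure V).map π).topologicalClosure with hNdef
  obtain ⟨F, hF⟩ := hC.elim_finite_subcover (fun f : H => {q : Q | (π f)⁻¹ * q ∈ N})
    (fun f => hN.preimage (continuous_const_mul _)) (by
      intro q _
      obtain ⟨f, hf⟩ := hπ.exists_mem_open (s := {p : Q | p⁻¹ * q ∈ N})
        (hN.preimage (by fun_prop)) ⟨q, by simp [one_mem]⟩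
      exact Set.mem_iUnion.2 ⟨f, hf⟩)
  obtain ⟨ξ, hξV, W, hW, hξW⟩ := hK.exists_seq_coboundary hcont b hb
    (hV.union F.finite_toSet.isCompact) (mem_of_superset hV1 Set.subset_union_left)
  -- The set `T` of points of pointwise convergence is an open subgroup; it contains the image of `V`,
  -- hence `N`, and the finitely many cosets of `N` that cover `C`.
  let D : ℕ → ρ.Z1 := fun n => b - ρ.coboundary (ξ n)
  let T : Subgroup Q :=
    { carrier := {q | Tendsto (fun n => ‖(D n).1 q‖) atTop (𝓝 0)}
      mul_mem' := by
        intro p q hp hq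
        refine squeeze_zero (fun n => norm_nonneg _) (fun n => Z1.norm_apply_mul_le (D n) p q) ?_
        simpa using Tendsto.add hq hp
      one_mem' := by
        simp [Z1.map_one]
      inv_mem' := by
        intro q hq
        simpa [Z1.norm_apply_inv] using hq }
  have hTW : ∀ q ∈ W, q ∈ T := by
    intro q hq
    change Tendsto _ _ _
    rw [Metric.tendsto_nhds]
    intro δ hδ
    filter_upwards [hξW (δ / 2) (by positivity)] with n hn
    rw [dist_zero_right, norm_norm]
    exact (hn q hq).trans_lt (by linarith)
  have hTo : IsOpen (T : Set Q) := Subgroup.isOpen_of_mem_nhds T (mem_of_superset hW hTW)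
  have hTV : ∀ h ∈ V ∪ F, π h ∈ T := fun h hh => by
    have := (hξV h hh).norm
    rw [norm_zero] at this
    exact this
  have hNT : N ≤ T := by
    refine Subgroup.topologicalClosure_minimal _ ?_ (Subgroup.isClosed_of_isOpen T hTo)
    rw [Subgroup.map_le_iff_le_comap, Subgroup.closure_le]
    exact fun h hh => hTV h (Or.inl hh)
  have hCT : C ⊆ T := by
    intro q hq
    obtain ⟨f, hf, hfq⟩ := Set.mem_iUnion₂.1 (hF hq)
    have := T.mul_mem (hTV f (Or.inr hf)) (hNT hfq)
    rwa [mul_inv_cancel_left] at this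
  obtain ⟨t, htC, ht⟩ := hC.elim_nhds_subcover (fun q => (fun p => q⁻¹ * p) ⁻¹' W) (fun q _ => by
    have : Tendsto (fun p : Q => q⁻¹ * p) (𝓝 q) (𝓝 1) := by
      simpa using (continuous_const_mul q⁻¹).tendsto q
    exact this hW)
  have hev : ∀ᶠ n in atTop, ∀ q ∈ t, ‖(D n).1 q‖ < ε / 2 := by
    rw [eventually_all_finset]
    intro q hq
    exact (show Tendsto (fun n => ‖(D n).1 q‖) atTop (𝓝 0) from hCT (htC q hq)).eventually
      (gt_mem_nhds (by positivity))
  obtain ⟨n, h1, h2⟩ := (hev.and (hξW (ε / 2) (by positivity))).exists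
  refine ⟨ξ n, fun q hq => ?_⟩
  obtain ⟨p, hp, hpq⟩ := Set.mem_iUnion₂.1 (ht hq)
  have h3 := Z1.norm_apply_mul_le (D n) p (p⁻¹ * q)
  rw [mul_inv_cancel_left] at h3
  have h4 := h1 p hp
  have h5 : ‖(D n).1 (p⁻¹ * q)‖ ≤ ε / 2 := h2 _ hpq
  change ‖(D n).1 q‖ ≤ ε
  linarith

end Reduced

/-! ### Open subgroups with compact image modulo the kernel of an action -/

section OpenSubgroup

/-- A locally compact group whose open subgroups intersect trivially has a compact open
subgroup. -/
theorem exists_compact_open_subgroup {G : Type*} [Group G] [TopologicalSpace G]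
    [IsTopologicalGroup G] [LocallyCompactSpace G] [T2Space G]
    (hsep : ∀ g : G, g ≠ 1 → ∃ W : Subgroup G, IsOpen (W : Set G) ∧ g ∉ W) :
    ∃ U : Subgroup G, IsOpen (U : Set G) ∧ IsCompact (U : Set G) := by
  obtain ⟨C, hC, hC1⟩ := exists_compact_mem_nhds (1 : G)
  have hfr : IsCompact (frontier C) := hC.of_isClosed_subset isClosed_frontier
    hC.isClosed.frontier_subset
  choose W hWo hW using hsep
  have h1 : (1 : G) ∉ frontier C := fun h => h.2 (mem_interior_iff_mem_nhds.2 hC1)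
  obtain ⟨t, ht⟩ := hfr.elim_finite_subcover
    (fun g : {g : G // g ≠ 1} => ((W g.1 g.2 : Subgroup G) : Set G)ᶜ)
    (fun g => ((W g.1 g.2).isClosed_of_isOpen (hWo g.1 g.2)).isOpen_compl)
    (fun g hg => Set.mem_iUnion.2 ⟨⟨g, fun h => h1 (h ▸ hg)⟩, hW g _⟩)
  let V : Subgroup G := ⨅ g ∈ t, W g.1 g.2
  have hVc : (V : Set G) = ⋂ g ∈ t, (W g.1 g.2 : Set G) := by
    simp only [V, Subgroup.coe_iInf]
  have hVo : IsOpen (V : Set G) := by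
    rw [hVc]
    exact isOpen_biInter_finset fun g _ => hWo g.1 g.2
  have hVfr : Disjoint (V : Set G) (frontier C) := by
    rw [Set.disjoint_left]
    intro g hg hgC
    obtain ⟨i, hi, hgi⟩ := Set.mem_iUnion₂.1 (ht hgC)
    rw [hVc] at hg
    exact hgi (Set.mem_iInter₂.1 hg i hi)
  -- `V ∩ C` is compact, and open because `V` misses the frontier of `C`.
  have hVC : (V : Set G) ∩ C = (V : Set G) ∩ interior C := by
    refine Set.Subset.antisymm (fun g hg => ⟨hg.1, ?_⟩)
      (Set.inter_subset_inter_right _ interior_subset)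
    by_contra h
    exact Set.disjoint_left.1 hVfr hg.1 ⟨subset_closure hg.2, h⟩
  have hDo : IsOpen ((V : Set G) ∩ C) := hVC ▸ hVo.inter isOpen_interior
  have hDc : IsCompact ((V : Set G) ∩ C) :=
    hC.inter_left (V.isClosed_of_isOpen hVo)
  obtain ⟨N, hN, hDN⟩ := compact_open_separated_mul_right hDc hDo subset_rfl
  have hsub : ((Subgroup.closure (N ∩ N⁻¹) : Subgroup G) : Set G) ⊆ (V : Set G) ∩ C := by
    have h2 : ∀ g ∈ Subgroup.closure (N ∩ N⁻¹), ∀ d ∈ (V : Set G) ∩ C, d * g ∈ (V : Set G) ∩ C := by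
      intro g hg
      induction hg using Subgroup.closure_induction'' with
      | mem x hx => exact fun d hd => hDN (Set.mul_mem_mul hd hx.1)
      | inv_mem x hx => exact fun d hd => hDN (Set.mul_mem_mul hd hx.2)
      | one =>
        intro d hd
        rwa [mul_one]
      | mul x y _ _ hx hy =>
        intro d hd
        rw [← mul_assoc]
        exact hy _ (hx d hd)
    exact fun g hg => by
      simpa using h2 g hg 1 ⟨one_mem V, mem_of_mem_nhds hC1⟩
  have hUo : IsOpen ((Subgroup.closure (N ∩ N⁻¹) : Subgroup G) : Set G) := by
    refine Subgroup.isOpen_of_mem_nhds _ (g := 1) ?_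
    exact mem_of_superset (inter_mem hN (inv_mem_nhds_one G hN)) Subgroup.subset_closure
  exact ⟨_, hUo, hDc.of_isClosed_subset (Subgroup.isClosed_of_isOpen _ hUo) hsub⟩

theorem isOpen_stabilizer_of_discrete (H : Type u) [Group H] [TopologicalSpace H]
    (X : Type v) [TopologicalSpace X] [DiscreteTopology X] [MulAction H X] [ContinuousSMul H X]
    (x : X) : IsOpen (MulAction.stabilizer H x : Set H) := by
  have h1 : Continuous fun h : H => h • x := by fun_prop
  exact (isOpen_discrete ({x} : Set X)).preimage h1

variable (H : Type u) [Group H] [TopologicalSpace H] [IsTopologicalGroup H] [LocallyCompactSpace H]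
  (X : Type v) [TopologicalSpace X] [DiscreteTopology X] [MulAction H X] [ContinuousSMul H X]

/-- There is an open subgroup of `H` containing the kernel `N` of the action on `X` and having
compact image in `H ⧸ N`. -/
theorem exists_open_subgroup_relIndex_ne_zero :
    ∃ U : Subgroup H, IsOpen (U : Set H) ∧ (MulAction.toPermHom H X).ker ≤ U ∧
      ∀ V : Subgroup H, IsOpen (V : Set H) → (MulAction.toPermHom H X).ker ≤ V →
        V.relIndex U ≠ 0 := by
  set N := (MulAction.toPermHom H X).ker with hN
  have hmem : ∀ n, n ∈ N ↔ ∀ x : X, n • x = x := fun n => by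
    rw [hN, MonoidHom.mem_ker, Equiv.ext_iff]
    rfl
  have hNc : IsClosed (N : Set H) := by
    have h1 : (N : Set H) = ⋂ x : X, (MulAction.stabilizer H x : Set H) := by
      ext n
      simp [hmem]
    rw [h1]
    exact isClosed_iInter fun x =>
      Subgroup.isClosed_of_isOpen _ (isOpen_stabilizer_of_discrete H X x)
  let q := QuotientGroup.mk' N
  have hqo : IsOpenMap q := QuotientGroup.isOpenMap_coe
  have hqc : Continuous q := QuotientGroup.continuous_mk
  have hcomap : ∀ V : Subgroup H, N ≤ V → (V.map q).comap q = V := fun V hV => by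
    rw [Subgroup.comap_map_eq, QuotientGroup.ker_mk', sup_eq_left.2 hV]
  obtain ⟨U, hUo, hUc⟩ := exists_compact_open_subgroup (G := H ⧸ N) (by
    intro g hg
    obtain ⟨h, rfl⟩ := QuotientGroup.mk'_surjective N g
    have h1 : h ∉ N := fun hh => hg ((QuotientGroup.eq_one_iff h).2 hh)
    rw [hmem] at h1
    push Not at h1
    obtain ⟨x, hx⟩ := h1
    refine ⟨(MulAction.stabilizer H x).map q, hqo _ (isOpen_stabilizer_of_discrete H X x),
      fun hh => hx ?_⟩
    have h2 : h ∈ ((MulAction.stabilizer H x).map q).comap q := hh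
    rwa [hcomap _ fun n hn => (hmem n).1 hn x] at h2)
  refine ⟨U.comap q, hUo.preimage hqc, fun n hn => ?_, fun V hVo hNV => ?_⟩
  · rw [Subgroup.mem_comap, show q n = 1 from (QuotientGroup.eq_one_iff n).2 hn]
    exact one_mem U
  · have hfin : ((V.map q).subgroupOf U).index ≠ 0 := by
      have : CompactSpace U := isCompact_iff_compactSpace.1 hUc
      have ho : IsOpen (((V.map q).subgroupOf U : Subgroup U) : Set U) :=
        (hqo _ hVo).preimage continuous_subtype_val
      have := Subgroup.quotient_finite_of_isOpen _ ho
      exact Subgroup.index_ne_zero_of_finite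
    have h3 : (V.map q).relIndex U ≠ 0 := hfin
    have h4 := Subgroup.relIndex_comap (V.map q) q (U.comap q)
    rw [hcomap V hNV, Subgroup.map_comap_eq_self_of_surjective (QuotientGroup.mk'_surjective N)] at h4
    rwa [h4]

end OpenSubgroup

/-! ### Orbit averages and invariant means -/

section OrbitAverage

theorem toFinset_orbit_eq {H : Type u} [Group H] {X : Type v} [MulAction H X]
    {U : Subgroup H} (hU : ∀ x : X, (MulAction.orbit U x).Finite) {x y : X}
    (h : y ∈ MulAction.orbit U x) : (hU y).toFinset = (hU x).toFinset := by
  ext z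
  simp only [Set.Finite.mem_toFinset]
  rw [MulAction.orbit_eq_iff.2 h]

theorem card_orbit_pos {H : Type u} [Group H] {X : Type v} [MulAction H X]
    {U : Subgroup H} (hU : ∀ x : X, (MulAction.orbit U x).Finite) (x : X) :
    (0 : ℝ) < (hU x).toFinset.card := by
  have hne : (hU x).toFinset.Nonempty := ⟨x, by simp [MulAction.mem_orbit_self]⟩
  exact_mod_cast hne.card_pos

variable {H : Type u} [Group H] {X : Type v} [TopologicalSpace X] [DiscreteTopology X]
  [MulAction H X]

/-- The average of a bounded function over the orbits of a subgroup with finite orbits. -/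
noncomputable def orbitAverage {U : Subgroup H} (hU : ∀ x : X, (MulAction.orbit U x).Finite)
    (F : X →ᵇ ℝ) : X →ᵇ ℝ :=
  BoundedContinuousFunction.ofNormedAddCommGroupDiscrete
    (fun x => ((hU x).toFinset.card : ℝ)⁻¹ * ∑ y ∈ (hU x).toFinset, F y) ‖F‖ (fun x => by
      have hne : (hU x).toFinset.Nonempty := ⟨x, by simp [MulAction.mem_orbit_self]⟩
      have hpos : (0 : ℝ) < (hU x).toFinset.card := by exact_mod_cast hne.card_pos
      rw [norm_mul, norm_inv, Real.norm_natCast, inv_mul_le_iff₀ hpos]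
      refine (norm_sum_le_of_le _ fun y _ => F.norm_coe_le_norm y).trans_eq ?_
      rw [Finset.sum_const, nsmul_eq_mul])

theorem orbitAverage_apply {U : Subgroup H} (hU : ∀ x : X, (MulAction.orbit U x).Finite)
    (F : X →ᵇ ℝ) (x : X) : orbitAverage hU F x =
      ((hU x).toFinset.card : ℝ)⁻¹ * ∑ y ∈ (hU x).toFinset, F y := rfl

theorem orbitAverage_eq_of_mem {U : Subgroup H} (hU : ∀ x : X, (MulAction.orbit U x).Finite)
    (F : X →ᵇ ℝ) {x y : X} (h : y ∈ MulAction.orbit U x) :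
    orbitAverage hU F y = orbitAverage hU F x := by
  rw [orbitAverage_apply, orbitAverage_apply, toFinset_orbit_eq hU h]

/-- A function that is constant along an orbit is determined there by its sum. -/
theorem eq_orbitAverage {U : Subgroup H} (hU : ∀ x : X, (MulAction.orbit U x).Finite)
    (F F' : X →ᵇ ℝ) (x : X) (hF' : ∀ y ∈ MulAction.orbit U x, F' y = F' x)
    (hsum : ∑ y ∈ (hU x).toFinset, F' y = ∑ y ∈ (hU x).toFinset, F y) :
    F' x = orbitAverage hU F x := by
  rw [orbitAverage_apply, ← hsum, Finset.sum_congr rfl (g := fun _ => F' x) fun y hy =>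
    hF' y ((hU x).mem_toFinset.1 hy), Finset.sum_const, nsmul_eq_mul,
    inv_mul_cancel_left₀ (card_orbit_pos hU x).ne']

/-- Averaging over `V`-orbits does not change the average over orbits of a larger group `U`. -/
theorem orbitAverage_orbitAverage {U V : Subgroup H} (hVU : V ≤ U)
    (hU : ∀ x : X, (MulAction.orbit U x).Finite) (hV : ∀ x : X, (MulAction.orbit V x).Finite)
    (F : X →ᵇ ℝ) : orbitAverage hU (orbitAverage hV F) = orbitAverage hU F := by
  ext x
  rw [orbitAverage_apply, orbitAverage_apply]
  congr 1
  have hsub : ∀ y ∈ MulAction.orbit U x, ∀ z ∈ MulAction.orbit V y, z ∈ MulAction.orbit U x := by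
    rintro _ ⟨u, rfl⟩ _ ⟨v, rfl⟩
    exact ⟨⟨v, hVU v.2⟩ * u, mul_smul (v : H) (u : H) x⟩
  simp only [orbitAverage_apply, Finset.mul_sum]
  rw [Finset.sum_comm' (t' := (hU x).toFinset) (s' := fun z => (hV z).toFinset) (by
    intro y z
    simp only [Set.Finite.mem_toFinset]
    constructor
    · rintro ⟨hy, hz⟩
      exact ⟨MulAction.mem_orbit_symm.1 hz, hsub y hy z hz⟩
    · rintro ⟨hy, hz⟩
      exact ⟨hsub z hz y hy, MulAction.mem_orbit_symm.1 hy⟩)]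
  refine Finset.sum_congr rfl fun z _ => ?_
  rw [Finset.sum_congr rfl (g := fun _ => ((hV z).toFinset.card : ℝ)⁻¹ * F z) fun y hy => by
    rw [toFinset_orbit_eq hV ((hV z).mem_toFinset.1 hy)], Finset.sum_const, nsmul_eq_mul,
    mul_inv_cancel_left₀ (card_orbit_pos hV z).ne']

/-- The translate `x ↦ F (g • x)` of a bounded function. -/
def smulComp (g : H) (F : X →ᵇ ℝ) : X →ᵇ ℝ :=
  F.compContinuous ⟨fun x : X => g • x, continuous_of_discreteTopology⟩

theorem smulComp_apply (g : H) (F : X →ᵇ ℝ) (x : X) : smulComp g F x = F (g • x) := rfl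

/-- Translation by `k` turns averages over `U`-orbits into averages over `k U k⁻¹`-orbits. -/
theorem orbitAverage_translate {U V : Subgroup H} (k : H) (hUV : ∀ h, h ∈ V ↔ k⁻¹ * h * k ∈ U)
    (hU : ∀ x : X, (MulAction.orbit U x).Finite) (hV : ∀ x : X, (MulAction.orbit V x).Finite)
    (F : X →ᵇ ℝ) : orbitAverage hU (smulComp k F) = smulComp k (orbitAverage hV F) := by
  ext x
  rw [smulComp_apply, orbitAverage_apply, orbitAverage_apply]
  have himg : (hV (k • x)).toFinset = (hU x).toFinset.map (MulAction.toPerm k).toEmbedding := by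
    ext z
    simp only [Set.Finite.mem_toFinset, Finset.mem_map, Equiv.coe_toEmbedding,
      MulAction.toPerm_apply]
    constructor
    · rintro ⟨v, rfl⟩
      refine ⟨(k⁻¹ * v * k) • x, ⟨⟨_, (hUV v).1 v.2⟩, rfl⟩, ?_⟩
      rw [smul_smul, mul_assoc, mul_inv_cancel_left, mul_smul]
      rfl
    · rintro ⟨_, ⟨u, rfl⟩, rfl⟩
      refine ⟨⟨k * u * k⁻¹, (hUV _).2 (by simp [mul_assoc])⟩, ?_⟩
      change (k * (u : H) * k⁻¹) • k • x = k • (u : H) • x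
      rw [smul_smul, inv_mul_cancel_right, mul_smul]
  rw [himg, Finset.card_map, Finset.sum_map]
  rfl

/-- For a `V`-invariant function, the average over orbits of a group `U` in which `V` has finite
index is an average of finitely many translates; hence it has the same invariant mean. -/
theorem mean_orbitAverage_of_invariant (m : (X →ᵇ ℝ) →ₗ[ℝ] ℝ)
    (hm : ∀ (g : H) (F : X →ᵇ ℝ), m (smulComp g F) = m F)
    {U V : Subgroup H} (hVU : V.relIndex U ≠ 0)
    (hU : ∀ x : X, (MulAction.orbit U x).Finite) (F : X →ᵇ ℝ)
    (hF : ∀ v ∈ V, ∀ x, F (v • x) = F x) : m (orbitAverage hU F) = m F := by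
  classical
  have : (V.subgroupOf U).FiniteIndex := ⟨hVU⟩
  have : Finite (U ⧸ V.subgroupOf U) := Subgroup.finite_quotient_of_finiteIndex
  have := Fintype.ofFinite (U ⧸ V.subgroupOf U)
  set n : ℝ := (Fintype.card (U ⧸ V.subgroupOf U) : ℝ) with hn
  have hn0 : n ≠ 0 := by
    rw [hn]
    exact_mod_cast Fintype.card_ne_zero
  let Φ : X →ᵇ ℝ := n⁻¹ • ∑ c : U ⧸ V.subgroupOf U, smulComp ((c.out : U) : H)⁻¹ F
  have hΦ : ∀ x, Φ x = n⁻¹ * ∑ c : U ⧸ V.subgroupOf U, F (((c.out : U) : H)⁻¹ • x) := fun x => by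
    simp [Φ, smulComp_apply]
  have hout : ∀ (u : U) (x : X),
      F ((((u : U ⧸ V.subgroupOf U).out : U) : H)⁻¹ • x) = F ((u : H)⁻¹ • x) := by
    intro u x
    obtain ⟨v, hv⟩ := QuotientGroup.mk_out_eq_mul (V.subgroupOf U) u
    rw [hv, Subgroup.coe_mul, mul_inv_rev, mul_smul]
    exact hF _ (inv_mem (Subgroup.mem_subgroupOf.1 v.2)) _
  have hinv : ∀ (u : U) (x : X), Φ ((u : H) • x) = Φ x := by
    intro u x
    rw [hΦ, hΦ]
    congr 1
    refine (Equiv.sum_comp (MulAction.toPerm u : Equiv.Perm (U ⧸ V.subgroupOf U))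
      fun c => F (((c.out : U) : H)⁻¹ • (u : H) • x)).symm.trans
      (Finset.sum_congr rfl fun c _ => ?_)
    have h1 : MulAction.toPerm u c = ((u * c.out : U) : U ⧸ V.subgroupOf U) := by
      conv_lhs => rw [← QuotientGroup.out_eq' c]
      rfl
    rw [h1, hout, Subgroup.coe_mul, mul_inv_rev, mul_smul, inv_smul_smul]
  have hΦeq : orbitAverage hU F = Φ := by
    ext x
    refine (eq_orbitAverage hU F Φ x ?_ ?_).symm
    · rintro _ ⟨u, rfl⟩
      exact hinv u x
    · simp only [hΦ, ← Finset.mul_sum]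
      rw [Finset.sum_comm]
      have h2 : ∀ c : U ⧸ V.subgroupOf U, ∑ y ∈ (hU x).toFinset, F (((c.out : U) : H)⁻¹ • y) =
          ∑ y ∈ (hU x).toFinset, F y := by
        intro c
        refine Finset.sum_equiv (MulAction.toPerm ((c.out : U) : H)⁻¹) (fun y => ?_) fun y _ => rfl
        simp only [Set.Finite.mem_toFinset, MulAction.toPerm_apply]
        change y ∈ MulAction.orbit U x ↔ (c.out : U)⁻¹ • y ∈ MulAction.orbit U x
        rw [← MulAction.orbit_eq_iff, ← MulAction.orbit_eq_iff, MulAction.orbit_smul]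
      rw [Finset.sum_congr rfl fun c _ => h2 c, Finset.sum_const, nsmul_eq_mul, Finset.card_univ,
        inv_mul_cancel_left₀ hn0]
  rw [hΦeq, map_smul, map_sum, Finset.sum_congr rfl fun c _ => hm _ F, Finset.sum_const,
    nsmul_eq_mul, Finset.card_univ, smul_eq_mul, inv_mul_cancel_left₀ hn0]

/-- An invariant mean does not distinguish averages over the orbits of two subgroups with finite
orbits that share a subgroup of finite index. -/
theorem mean_orbitAverage_eq (m : (X →ᵇ ℝ) →ₗ[ℝ] ℝ)
    (hm : ∀ (g : H) (F : X →ᵇ ℝ), m (smulComp g F) = m F)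
    {U V : Subgroup H} (hVU : V ≤ U) (hindex : V.relIndex U ≠ 0)
    (hU : ∀ x : X, (MulAction.orbit U x).Finite) (hV : ∀ x : X, (MulAction.orbit V x).Finite)
    (F : X →ᵇ ℝ) : m (orbitAverage hU F) = m (orbitAverage hV F) := by
  rw [← orbitAverage_orbitAverage hVU hU hV F]
  exact mean_orbitAverage_of_invariant m hm hindex hU _ fun v hv x =>
    orbitAverage_eq_of_mem hV F ⟨⟨v, hv⟩, rfl⟩

end OrbitAverage

/-! ### Almost invariant vectors from invariant means -/

section InvariantMean

theorem finite_orbit_of_relIndex_ne_zero {H : Type u} [Group H] {X : Type v} [MulAction H X]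
    {U : Subgroup H} {x : X} (h : (MulAction.stabilizer H x).relIndex U ≠ 0) :
    (MulAction.orbit U x).Finite := by
  have h1 : ((MulAction.stabilizer H x).subgroupOf U).FiniteIndex := ⟨h⟩
  have h2 : (MulAction.stabilizer H x).subgroupOf U = MulAction.stabilizer U x := rfl
  rw [h2] at h1
  have h3 : Finite (U ⧸ MulAction.stabilizer U x) := Subgroup.finite_quotient_of_finiteIndex
  exact Set.finite_coe_iff.1
    (Finite.of_equiv _ (MulAction.orbitEquivQuotientStabilizer U x).symm)

/-- If an open subgroup `U` has compact image modulo the kernel of the action, it is commensurable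
with its conjugates, so averaging an invariant mean over `U`-orbits gives a functional that is still
invariant. -/
theorem mean_orbitAverage_smulComp {H : Type u} [Group H] [TopologicalSpace H]
    [IsTopologicalGroup H] {X : Type v} [TopologicalSpace X] [DiscreteTopology X] [MulAction H X]
    [ContinuousSMul H X] (m : (X →ᵇ ℝ) →ₗ[ℝ] ℝ)
    (hm : ∀ (g : H) (F : X →ᵇ ℝ), m (smulComp g F) = m F)
    {U : Subgroup H} (hUo : IsOpen (U : Set H)) (hNU : (MulAction.toPermHom H X).ker ≤ U)
    (hindex : ∀ V : Subgroup H, IsOpen (V : Set H) → (MulAction.toPermHom H X).ker ≤ V →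
      V.relIndex U ≠ 0)
    (hU : ∀ x : X, (MulAction.orbit U x).Finite) (k : H) (F : X →ᵇ ℝ) :
    m (orbitAverage hU (smulComp k F)) = m (orbitAverage hU F) := by
  have hcomap : ∀ (g : H) (V : Subgroup H), IsOpen (V : Set H) →
      (MulAction.toPermHom H X).ker ≤ V →
      IsOpen (V.comap (MulAut.conj g).toMonoidHom : Set H) ∧
        (MulAction.toPermHom H X).ker ≤ V.comap (MulAut.conj g).toMonoidHom := by
    intro g V hVo hNV
    refine ⟨hVo.preimage (f := fun h => g * h * g⁻¹) (by fun_prop), fun n hn => hNV ?_⟩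
    exact (MonoidHom.normal_ker _).conj_mem n hn g
  obtain ⟨hWo, hNW⟩ := hcomap k⁻¹ U hUo hNU
  set W : Subgroup H := U.comap (MulAut.conj k⁻¹).toMonoidHom with hWdef
  have hmemW : ∀ h, h ∈ W ↔ k⁻¹ * h * k ∈ U := fun h => by
    rw [hWdef, Subgroup.mem_comap]
    simp
  have hindexW : ∀ V : Subgroup H, IsOpen (V : Set H) → (MulAction.toPermHom H X).ker ≤ V →
      V.relIndex W ≠ 0 := by
    intro V hVo hNV
    obtain ⟨h1, h2⟩ := hcomap k V hVo hNV
    have h3 : V = (V.comap (MulAut.conj k).toMonoidHom).comap (MulAut.conj k⁻¹).toMonoidHom := by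
      ext h
      simp [Subgroup.mem_comap, mul_assoc]
    rw [h3, Subgroup.relIndex_comap, hWdef,
      Subgroup.map_comap_eq_self_of_surjective (MulAut.conj k⁻¹).surjective]
    exact hindex _ h1 h2
  have hstab : ∀ x : X, IsOpen (MulAction.stabilizer H x : Set H) ∧
      (MulAction.toPermHom H X).ker ≤ MulAction.stabilizer H x := fun x =>
    ⟨isOpen_stabilizer_of_discrete H X x, fun n hn => Equiv.congr_fun (MonoidHom.mem_ker.1 hn) x⟩
  have hW : ∀ x : X, (MulAction.orbit W x).Finite := fun x =>
    finite_orbit_of_relIndex_ne_zero (hindexW _ (hstab x).1 (hstab x).2)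
  have hUWo : IsOpen ((U ⊓ W : Subgroup H) : Set H) := hUo.inter hWo
  have hNUW : (MulAction.toPermHom H X).ker ≤ U ⊓ W := le_inf hNU hNW
  have hUW : ∀ x : X, (MulAction.orbit (U ⊓ W : Subgroup H) x).Finite := fun x =>
    (hU x).subset (by
      rintro _ ⟨u, rfl⟩
      exact ⟨⟨u, u.2.1⟩, rfl⟩)
  rw [orbitAverage_translate k hmemW hU hW, hm,
    mean_orbitAverage_eq m hm inf_le_right (hindexW _ hUWo hNUW) hW hUW,
    mean_orbitAverage_eq m hm inf_le_left (hindex _ hUWo hNUW) hU hUW]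

/-- From a mean to almost invariant probability densities, by the Hahn–Banach separation theorem
applied to the convex set of all tuples `(k p - p)_k`, with `p` a `U`-invariant density. -/
theorem exists_almost_invariant_density {H : Type u} [Group H] {X : Type v}
    [TopologicalSpace X] [DiscreteTopology X] [MulAction H X] (m : (X →ᵇ ℝ) →ₗ[ℝ] ℝ)
    (hpos : ∀ F : X →ᵇ ℝ, 0 ≤ F → 0 ≤ m F) (hone : m 1 = 1)
    {U : Subgroup H} (hU : ∀ x : X, (MulAction.orbit U x).Finite)
    (hm : ∀ (k : H) (F : X →ᵇ ℝ), m (orbitAverage hU (smulComp k F)) = m (orbitAverage hU F))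
    (T : Finset H) {ε : ℝ} (hε : 0 < ε) :
    ∃ p : X → ℝ, (∀ y, 0 ≤ p y) ∧ HasSum p 1 ∧ (∀ u ∈ U, ∀ y, p (u • y) = p y) ∧
      ∀ k ∈ T, ∑' y, |p (k⁻¹ • y) - p y| ≤ ε := by
  classical
  let C : Set (T → lp (fun _ : X => ℝ) 1) := {S | ∃ p : X → ℝ, (∀ y, 0 ≤ p y) ∧ HasSum p 1 ∧
    (∀ u ∈ U, ∀ y, p (u • y) = p y) ∧ ∀ (k : T) (y : X), S k y = p ((k : H)⁻¹ • y) - p y}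
  suffices h0 : (0 : T → lp (fun _ : X => ℝ) 1) ∈ closure C by
    obtain ⟨S, ⟨p, hp0, hp1, hpU, hS⟩, hdist⟩ := Metric.mem_closure_iff.1 h0 ε hε
    refine ⟨p, hp0, hp1, hpU, fun k hk => ?_⟩
    have h1 : ‖S ⟨k, hk⟩‖ ≤ ε := by
      rw [dist_zero_left] at hdist
      exact (norm_le_pi_norm S ⟨k, hk⟩).trans hdist.le
    rw [lp.norm_eq_tsum_rpow (by norm_num)] at h1
    simpa [hS] using h1
  by_contra h0
  have hconv : Convex ℝ C := by
    rintro S ⟨p, hp0, hp1, hpU, hS⟩ S' ⟨p', hp0', hp1', hpU', hS'⟩ a b ha hb hab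
    refine ⟨fun y => a * p y + b * p' y, fun y => by have := hp0 y; have := hp0' y; positivity,
      ?_, fun u hu y => by simp only [hpU u hu, hpU' u hu],
      fun k y => ?_⟩
    · simpa [hab] using (hp1.mul_left a).add (hp1'.mul_left b)
    · have h1 : (a • S + b • S') k y = a * S k y + b * S' k y := rfl
      rw [h1, hS, hS']
      ring
  obtain ⟨L, c, hc0, hc⟩ := geometric_hahn_banach_point_closed hconv.closure isClosed_closure h0
  rw [map_zero] at hc0
  let δ : T → X → (T → lp (fun _ : X => ℝ) 1) := fun k y => Pi.single k (lp.single 1 y 1)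
  have hδ : ∀ k y, ‖δ k y‖ ≤ 1 := fun k y => by
    rw [Pi.norm_single, lp.norm_single (by norm_num), norm_one]
  -- The functional `L` is given by bounded functions `F k`.
  let F : T → (X →ᵇ ℝ) := fun k => BoundedContinuousFunction.ofNormedAddCommGroupDiscrete
    (fun y => L (δ k y)) ‖L‖ (fun y => (L.le_opNorm _).trans
      (mul_le_of_le_one_right (norm_nonneg _) (hδ k y)))
  have hF : ∀ k y, F k y = L (δ k y) := fun k y => rfl
  let D : X →ᵇ ℝ := ∑ k : T, (orbitAverage hU (smulComp (k : H) (F k)) - orbitAverage hU (F k))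
  have hmD : m D = 0 := by
    simp only [D, map_sum, map_sub, hm, sub_self, Finset.sum_const_zero]
  have hDc : ∀ x, c ≤ D x := by
    intro x
    let S : T → lp (fun _ : X => ℝ) 1 := ∑ k : T, ((hU x).toFinset.card : ℝ)⁻¹ •
      ∑ y ∈ (hU x).toFinset, (δ k ((k : H) • y) - δ k y)
    have hS : L S = D x := by
      simp [S, D, orbitAverage_apply, smulComp_apply, hF, Finset.sum_sub_distrib, mul_sub]
    rw [← hS]
    refine (hc S (subset_closure ⟨fun y => if y ∈ (hU x).toFinset then
      ((hU x).toFinset.card : ℝ)⁻¹ else 0, fun y => by positivity, ?_, fun u hu y => ?_,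
      fun k y => ?_⟩)).le
    · have h1 := hasSum_sum_of_ne_finset_zero (L := .unconditional X)
        (s := (hU x).toFinset) (f := fun y =>
        if y ∈ (hU x).toFinset then ((hU x).toFinset.card : ℝ)⁻¹ else 0)
        (fun y hy => if_neg hy)
      rwa [Finset.sum_congr rfl fun y hy => if_pos hy, Finset.sum_const, nsmul_eq_mul,
        mul_inv_cancel₀ (card_orbit_pos hU x).ne'] at h1
    · have h1 : u • y ∈ (hU x).toFinset ↔ y ∈ (hU x).toFinset := by
        rw [Set.Finite.mem_toFinset, Set.Finite.mem_toFinset]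
        change (⟨u, hu⟩ : U) • y ∈ MulAction.orbit U x ↔ _
        rw [← MulAction.orbit_eq_iff, ← MulAction.orbit_eq_iff, MulAction.orbit_smul]
      simp only [h1]
    · have h1 : S k = ((hU x).toFinset.card : ℝ)⁻¹ •
          ∑ z ∈ (hU x).toFinset, (lp.single 1 ((k : H) • z) (1 : ℝ) - lp.single 1 z 1) := by
        simp only [S, δ, Finset.sum_apply, Pi.smul_apply, Pi.sub_apply]
        rw [Finset.sum_eq_single k (fun j _ hj => by simp [hj.symm]) (by simp)]
        simp
      have h2 : ∀ z : X, (lp.single 1 ((k : H) • z) (1 : ℝ) : lp (fun _ : X => ℝ) 1) y =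
          if z = (k : H)⁻¹ • y then 1 else 0 := fun z => by
        rw [lp.single_apply, Pi.single_apply]
        exact if_congr ⟨fun h => by rw [h, inv_smul_smul], fun h => by rw [h, smul_inv_smul]⟩ rfl rfl
      have h3 : ∀ z : X, (lp.single 1 z (1 : ℝ) : lp (fun _ : X => ℝ) 1) y =
          if z = y then 1 else 0 := fun z => by
        rw [lp.single_apply, Pi.single_apply]
        exact if_congr eq_comm rfl rfl
      rw [h1, lp.coeFn_smul, Pi.smul_apply, lp.coeFn_sum, Finset.sum_apply]
      simp only [lp.coeFn_sub, Pi.sub_apply, h2, h3, Finset.sum_sub_distrib, Finset.sum_ite_eq',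
        smul_eq_mul, mul_sub, mul_ite, mul_one, mul_zero]
  have h1 : 0 ≤ m (D - c • 1) := hpos _ fun x => by simpa using hDc x
  rw [map_sub, map_smul, hone, hmD, smul_eq_mul, mul_one] at h1
  linarith

/-- An invariant mean on `X` yields almost invariant unit vectors in `ℓ²(X)`: the square roots of
almost invariant densities. -/
theorem EymardAmenable.almostHasInvariantVectors {H : Type u} [Group H] [TopologicalSpace H]
    [IsTopologicalGroup H] [LocallyCompactSpace H] {X : Type v} [TopologicalSpace X]
    [DiscreteTopology X] [MulAction H X] [ContinuousSMul H X] (h : EymardAmenable H X) :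
    (ellTwoRep H X).AlmostHasInvariantVectors := by
  obtain ⟨m, hpos, hone, hm⟩ := h
  obtain ⟨U, hUo, hNU, hindex⟩ := exists_open_subgroup_relIndex_ne_zero H X
  have hU : ∀ x : X, (MulAction.orbit U x).Finite := fun x =>
    finite_orbit_of_relIndex_ne_zero (hindex _ (isOpen_stabilizer_of_discrete H X x)
      fun n hn => Equiv.congr_fun (MonoidHom.mem_ker.1 hn) x)
  intro K hK ε hε
  -- Finitely many left cosets of `U` cover `K`.
  obtain ⟨T, hT⟩ := hK.elim_finite_subcover (fun k : H => (fun g => k⁻¹ * g) ⁻¹' (U : Set H))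
    (fun k => hUo.preimage (by fun_prop))
    (fun g _ => Set.mem_iUnion.2 ⟨g, by simp⟩)
  obtain ⟨p, hp0, hp1, hpU, hpT⟩ := exists_almost_invariant_density m hpos hone hU
    (mean_orbitAverage_smulComp m hm hUo hNU hindex hU) T (pow_pos hε 2)
  have hsq : ∀ y, √(p y) ^ 2 = p y := fun y => Real.sq_sqrt (hp0 y)
  let ξ : EllTwo X := ⟨fun y => √(p y), memℓp_gen (by simpa [hsq] using hp1.summable)⟩
  have hξ : ∀ y, ξ y = √(p y) := fun y => rfl
  refine ⟨ξ, ?_, fun g hg => ?_⟩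
  · have h1 := EllTwo.hasSum_sq ξ
    simp only [hξ, hsq] at h1
    have h2 : ‖ξ‖ ^ 2 = 1 := h1.unique hp1
    exact (pow_eq_one_iff_of_nonneg (norm_nonneg ξ) two_ne_zero).1 h2
  · obtain ⟨k, hkT, hk⟩ := Set.mem_iUnion₂.1 (hT hg)
    have hgk : ∀ y, p (g⁻¹ • y) = p (k⁻¹ • y) := fun y => by
      have h1 := hpU _ (inv_mem hk) (k⁻¹ • y)
      rwa [smul_smul, mul_inv_rev, inv_inv, mul_inv_cancel_right] at h1
    refine (sq_le_sq₀ (norm_nonneg _) hε.le).1 ((hasSum_le (fun y => ?_)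
      (EllTwo.hasSum_sq (ξ - (ellTwoRep H X).toHom g ξ)) (Summable.hasSum ?_)).trans (hpT k hkT))
    · have h1 : (ξ - (ellTwoRep H X).toHom g ξ) y = √(p y) - √(p (k⁻¹ • y)) := by
        rw [← hgk]
        rfl
      -- `(√a - √b)² ≤ |a - b|`
      rw [h1, ← sq_abs]
      have h2 := abs_nonneg (√(p y) - √(p (k⁻¹ • y)))
      have h3 : |√(p y) - √(p (k⁻¹ • y))| ≤ |√(p y) + √(p (k⁻¹ • y))| := by
        rw [abs_of_nonneg (add_nonneg (Real.sqrt_nonneg (p y)) (Real.sqrt_nonneg (p (k⁻¹ • y)))),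
          abs_le]
        constructor <;> linarith [Real.sqrt_nonneg (p y), Real.sqrt_nonneg (p (k⁻¹ • y))]
      have h4 : p y - p (k⁻¹ • y) =
          (√(p y) + √(p (k⁻¹ • y))) * (√(p y) - √(p (k⁻¹ • y))) := by
        rw [← sq_sub_sq, hsq, hsq]
      rw [abs_sub_comm (p (k⁻¹ • y)), h4, abs_mul, sq]
      exact mul_le_mul_of_nonneg_right h3 h2
    · have h1 : Summable fun y => p (k⁻¹ • y) :=
        ((MulAction.toPerm k⁻¹).summable_iff (f := p)).2 hp1.summable
      exact (h1.sub hp1.summable).abs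

end InvariantMean

/-! ### Transfer of the four properties -/

namespace OrthRep

section Vanishing

variable {G : Type u} [Group G] [TopologicalSpace G]
  {E : Type v} [NormedAddCommGroup E] [InnerProductSpace ℝ E] (ρ : OrthRep G E)

theorem subsingleton_H1_iff :
    Subsingleton ρ.H1 ↔ ∀ b : ρ.Z1, ∃ ξ : E, ∀ g, b.1 g = ξ - ρ.toHom g ξ := by
  rw [Submodule.Quotient.subsingleton_iff, Submodule.eq_top_iff']
  refine forall_congr' fun b => ⟨?_, ?_⟩
  · rintro ⟨ξ, rfl⟩
    exact ⟨ξ, fun g => rfl⟩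
  · rintro ⟨ξ, hξ⟩
    exact ⟨ξ, Subtype.ext (ContinuousMap.ext fun g => (hξ g).symm)⟩

theorem subsingleton_reducedH1_iff :
    Subsingleton ρ.ReducedH1 ↔ ∀ b : ρ.Z1, ∀ K : Set G, IsCompact K → ∀ ε : ℝ, 0 < ε →
      ∃ ξ : E, ∀ g ∈ K, ‖(b - ρ.coboundary ξ).1 g‖ ≤ ε := by
  rw [Submodule.Quotient.subsingleton_iff, Submodule.eq_top_iff']
  refine forall_congr' fun b => ?_
  rw [← SetLike.mem_coe, Submodule.topologicalClosure_coe,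
    Topology.IsInducing.subtypeVal.closure_eq_preimage_closure_image, Set.mem_preimage,
    mem_closure_iff_nhds_basis
      (nhds_basis_uniformity' Metric.uniformity_basis_dist_le.compactConvergenceUniformity)]
  constructor
  · intro h K hK ε hε
    obtain ⟨_, ⟨_, ⟨ξ, rfl⟩, rfl⟩, hξ⟩ := h (K, ε) ⟨hK, hε⟩
    exact ⟨ξ, fun g hg => (dist_eq_norm (b.1 g) _).symm.trans_le (hξ g hg)⟩
  · rintro h ⟨K, ε⟩ ⟨hK, hε⟩
    obtain ⟨ξ, hξ⟩ := h K hK ε hε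
    exact ⟨_, ⟨_, ⟨ξ, rfl⟩, rfl⟩, fun g hg => (dist_eq_norm (b.1 g) _).trans_le (hξ g hg)⟩

end Vanishing

section Intertwiner

variable {G : Type u} [Group G] [TopologicalSpace G]
  {E : Type v} [NormedAddCommGroup E] [InnerProductSpace ℝ E]
  {E' : Type w} [NormedAddCommGroup E'] [InnerProductSpace ℝ E']
  {ρ : OrthRep G E} {ρ' : OrthRep G E'} (T : E ≃ₗᵢ[ℝ] E')
  (hT : ∀ g x, T (ρ.toHom g x) = ρ'.toHom g (T x))

/-- The image of a cocycle under an isometric isomorphism of representations. -/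
def Z1.mapIso (b : ρ.Z1) : ρ'.Z1 :=
  ⟨⟨fun g => T (b.1 g), T.continuous.comp b.1.continuous⟩, fun g h => by
    simp only [ContinuousMap.coe_mk]
    rw [Z1.map_mul, _root_.map_add, hT]⟩

theorem AlmostHasInvariantVectors.of_equiv (T : E ≃ₗᵢ[ℝ] E')
    (hT : ∀ g x, T (ρ.toHom g x) = ρ'.toHom g (T x)) (h : ρ.AlmostHasInvariantVectors) :
    ρ'.AlmostHasInvariantVectors := by
  intro K hK ε hε
  obtain ⟨ξ, hξ1, hξ⟩ := h K hK ε hε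
  refine ⟨T ξ, by rw [LinearIsometryEquiv.norm_map, hξ1], fun g hg => ?_⟩
  rw [← hT, ← _root_.map_sub, LinearIsometryEquiv.norm_map]
  exact hξ g hg

end Intertwiner

end OrthRep

open OrthRep

/-- For a homomorphism with dense image, every point of a `Q`-orbit in a discrete `Q`-set is reached
from `H`. -/
theorem exists_map_smul_eq {H Q : Type*} [Group H] [Group Q] [TopologicalSpace Q] {π : H →* Q}
    (hπ : DenseRange π) {X : Type*} [TopologicalSpace X] [DiscreteTopology X] [MulAction Q X]
    [ContinuousSMul Q X] (q : Q) (x : X) : ∃ h, π h • x = q • x := by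
  have h1 : Continuous fun p : Q => p • x := by fun_prop
  exact hπ.exists_mem_open ((isOpen_discrete {q • x}).preimage h1) ⟨q, rfl⟩

section Pullback

variable {H Q : Type u} [Group H] [TopologicalSpace H] [Group Q] [TopologicalSpace Q]
  (π : H →* Q)

theorem continuousSMul_compHom (hcont : Continuous π) (X : Type v) [TopologicalSpace X]
    [MulAction Q X] [ContinuousSMul Q X] :
    letI := MulAction.compHom X π
    ContinuousSMul H X := by
  let := MulAction.compHom X π
  exact ⟨((hcont.comp continuous_fst).smul continuous_snd :
    Continuous fun p : H × X => π p.1 • p.2)⟩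

/-- The restriction of a cocycle along a continuous homomorphism. -/
def OrthRep.Z1.comp (hcont : Continuous π) {E : Type*} [NormedAddCommGroup E]
    [InnerProductSpace ℝ E] {ρ : OrthRep Q E} {σ : OrthRep H E}
    (hσ : ∀ h x, σ.toHom h x = ρ.toHom (π h) x) (b : ρ.Z1) : σ.Z1 :=
  ⟨⟨fun h => b.1 (π h), b.1.continuous.comp hcont⟩, fun g h => by
    simp only [ContinuousMap.coe_mk]
    rw [_root_.map_mul, OrthRep.Z1.map_mul, hσ]⟩

variable {π}

theorem PropertyDFH.of_denseRange (hcont : Continuous π) (hπ : DenseRange π)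
    (h : PropertyDFH H) : PropertyDFH Q := by
  intro X _ _ _ _
  let := MulAction.compHom X π
  have := continuousSMul_compHom π hcont X
  have hσ : ∀ g f, (ellTwoRep H X).toHom g f = (ellTwoRep Q X).toHom (π g) f := fun g f => by
    ext x
    rw [ellTwoRep_apply, ellTwoRep_apply, ← map_inv]
    rfl
  rw [subsingleton_H1_iff]
  intro b
  obtain ⟨ξ, hξ⟩ := (subsingleton_H1_iff _).1 (h X) (OrthRep.Z1.comp π hcont hσ b)
  refine ⟨ξ, congrFun (hπ.equalizer b.1.continuous
    (continuous_const.sub ((ellTwoRep Q X).continuous_orbit ξ)) (funext fun g => ?_))⟩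
  exact (hξ g).trans (by rw [hσ]; rfl)

theorem PropertyFM.of_denseRange (hcont : Continuous π) (hπ : DenseRange π)
    (h : PropertyFM H) : PropertyFM Q := by
  intro X _ _ _ _ hX
  let := MulAction.compHom X π
  have := continuousSMul_compHom π hcont X
  obtain ⟨m, hpos, hone, hm⟩ := hX
  obtain ⟨x, hx⟩ := h X ⟨m, hpos, hone, fun g f => hm (π g) f⟩
  refine ⟨x, hx.subset ?_⟩
  rintro _ ⟨q, rfl⟩
  obtain ⟨g, hg⟩ := exists_map_smul_eq hπ q x
  exact ⟨g, hg⟩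

theorem PropertyFM'.of_denseRange (hcont : Continuous π) (hπ : DenseRange π)
    (h : PropertyFM' H) : PropertyFM' Q := by
  intro X _ _ _ _ _ hX
  let := MulAction.compHom X π
  have := continuousSMul_compHom π hcont X
  obtain ⟨m, hpos, hone, hm⟩ := hX
  have : MulAction.IsPretransitive H X := ⟨fun x y => by
    obtain ⟨q, hq⟩ := MulAction.exists_smul_eq Q x y
    obtain ⟨g, hg⟩ := exists_map_smul_eq hπ q x
    exact ⟨g, hg.trans hq⟩⟩
  exact h X ⟨m, hpos, hone, fun g f => hm (π g) f⟩

end Pullback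

section Kazhdan

variable {H Q : Type u}
  [Group H] [TopologicalSpace H] [IsTopologicalGroup H]
  [Group Q] [TopologicalSpace Q] [IsTopologicalGroup Q]
  {π : H →* Q} {hπ : DenseRange π}

theorem IsKazhdanHom.propertyReducedDFH_of_left [LocallyCompactSpace H] [LocallyCompactSpace Q]
    (hK : IsKazhdanHom π hπ) (hcont : Continuous π)
    (h : PropertyReducedDFH H) : PropertyReducedDFH Q := by
  intro X _ _ _ _
  let := MulAction.compHom X π
  have := continuousSMul_compHom π hcont X
  have hσ : ∀ g f, (ellTwoRep H X).toHom g f = (ellTwoRep Q X).toHom (π g) f := fun g f => by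
    ext x
    rw [ellTwoRep_apply, ellTwoRep_apply, ← map_inv]
    rfl
  rw [subsingleton_reducedH1_iff]
  intro b K hKc ε hε
  refine hK.exists_coboundary_of_comp hcont b (fun C hC δ hδ => ?_) hKc hε
  obtain ⟨ξ, hξ⟩ := (subsingleton_reducedH1_iff _).1 (h X) (OrthRep.Z1.comp π hcont hσ b) C hC δ hδ
  refine ⟨ξ, fun g hg => le_of_eq_of_le ?_ (hξ g hg)⟩
  change ‖b.1 (π g) - (ξ - (ellTwoRep Q X).toHom (π g) ξ)‖ =
    ‖b.1 (π g) - (ξ - (ellTwoRep H X).toHom g ξ)‖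
  rw [hσ]

theorem IsKazhdanHom.propertyDFH_of_right
    (hK : IsKazhdanHom π hπ) (h : PropertyDFH Q) : PropertyDFH H := by
  intro X _ _ _ _
  obtain ⟨Y, _, _, _, _, T, A, hT, -⟩ := exists_qPoints_equiv_ellTwo X hπ
  rw [subsingleton_H1_iff]
  intro b
  obtain ⟨ξ, b', hb'⟩ := hK.exists_qRep_cocycle b
  obtain ⟨η, hη⟩ := (subsingleton_H1_iff _).1 (h Y) (OrthRep.Z1.mapIso T hT b')
  refine ⟨ξ + (T.symm η : EllTwo X), fun g => ?_⟩
  have h1 : b'.1 (π g) =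
      T.symm η - ((ellTwoRep H X).qRep π hπ).toHom (π g) (T.symm η) := by
    refine T.injective ?_
    rw [map_sub, hT, T.apply_symm_apply]
    exact hη (π g)
  have h2 := hb' g
  rw [h1, Submodule.coe_sub, qRep_apply] at h2
  rw [map_add, ← sub_eq_zero]
  rw [← sub_eq_zero] at h2
  rw [← neg_eq_zero, ← h2]
  abel

theorem IsKazhdanHom.propertyReducedDFH_of_right
    (hK : IsKazhdanHom π hπ) (hcont : Continuous π) (h : PropertyReducedDFH Q) :
    PropertyReducedDFH H := by
  intro X _ _ _ _
  obtain ⟨Y, _, _, _, _, T, A, hT, -⟩ := exists_qPoints_equiv_ellTwo X hπ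
  rw [subsingleton_reducedH1_iff]
  intro b K hKc ε hε
  obtain ⟨ξ, b', hb'⟩ := hK.exists_qRep_cocycle b
  obtain ⟨η, hη⟩ := (subsingleton_reducedH1_iff _).1 (h Y) (OrthRep.Z1.mapIso T hT b') (π '' K)
    (hKc.image hcont) ε hε
  refine ⟨ξ + (T.symm η : EllTwo X), fun g hg => ?_⟩
  have h1 : ‖T (b'.1 (π g)) - (η - (ellTwoRep Q Y).toHom (π g) η)‖ ≤ ε :=
    hη (π g) (Set.mem_image_of_mem π hg)
  have h2 : T (b'.1 (π g)) - (η - (ellTwoRep Q Y).toHom (π g) η) =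
      T (b'.1 (π g) - (T.symm η - ((ellTwoRep H X).qRep π hπ).toHom (π g) (T.symm η))) := by
    rw [map_sub, map_sub, hT, T.apply_symm_apply]
  rw [h2, T.norm_map, Submodule.coe_norm, Submodule.coe_sub, Submodule.coe_sub, qRep_apply,
    hb'] at h1
  refine le_of_eq_of_le (congrArg _ ?_) h1
  change b.1 g - (ξ + (T.symm η : EllTwo X) - (ellTwoRep H X).toHom g (ξ + (T.symm η : EllTwo X))) =
    _
  rw [map_add]
  abel

variable [LocallyCompactSpace H]

/-- The `Q`-set of atoms of an Eymard-amenable `H`-set is Eymard-amenable. -/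
theorem IsKazhdanHom.exists_amenable_atoms (hK : IsKazhdanHom π hπ) (X : Type u)
    [TopologicalSpace X] [DiscreteTopology X] [MulAction H X] [ContinuousSMul H X]
    (hX : EymardAmenable H X) :
    ∃ (Y : Type u) (_ : TopologicalSpace Y) (_ : DiscreteTopology Y) (_ : MulAction Q Y)
      (_ : ContinuousSMul Q Y) (A : Y → Set X), EymardAmenable Q Y ∧
      (∀ y, (A y).Finite ∧ (A y).Nonempty) ∧ (∀ h y x, x ∈ A y → h • x ∈ A (π h • y)) ∧
      ∀ y y' x, x ∈ A y → x ∈ A y' → y = y' := by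
  obtain ⟨Y, i1, i2, i3, i4, T, A, hT, hA, hsmul, hinj⟩ := exists_qPoints_equiv_ellTwo X hπ
  have h1 := hK _ _ hX.almostHasInvariantVectors
  exact ⟨Y, i1, i2, i3, i4, A, (h1.of_equiv T hT).eymardAmenable,
    fun y => ⟨(hA y).finite, (hA y).1⟩, fun h y x hx => (hsmul h y _).2 (by rwa [inv_smul_smul]),
    hinj⟩

theorem IsKazhdanHom.propertyFM_of_right (hK : IsKazhdanHom π hπ) (h : PropertyFM Q) :
    PropertyFM H := by
  intro X _ _ _ _ hX
  obtain ⟨Y, _, _, _, _, A, hY, hA, hsmul, -⟩ := hK.exists_amenable_atoms X hX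
  obtain ⟨y, hy⟩ := h Y hY
  obtain ⟨x, hx⟩ := (hA y).2
  refine ⟨x, (hy.biUnion fun z _ => (hA z).1).subset ?_⟩
  rintro _ ⟨g, rfl⟩
  exact Set.mem_biUnion ⟨π g, rfl⟩ (hsmul g y x hx)

theorem IsKazhdanHom.propertyFM'_of_right (hK : IsKazhdanHom π hπ) (h : PropertyFM' Q) :
    PropertyFM' H := by
  intro X _ _ _ _ _ hX
  obtain ⟨Y, _, _, _, _, A, hY, hA, hsmul, hinj⟩ := hK.exists_amenable_atoms X hX
  have : MulAction.IsPretransitive Q Y := ⟨fun y y' => by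
    obtain ⟨x, hx⟩ := (hA y).2
    obtain ⟨x', hx'⟩ := (hA y').2
    obtain ⟨g, rfl⟩ := MulAction.exists_smul_eq H x x'
    exact ⟨π g, hinj _ _ _ (hsmul g y x hx) hx'⟩⟩
  have := h Y hY
  -- The mean of the constant function `1` is `1`, so `Y` is not empty.
  obtain ⟨y⟩ : Nonempty Y := by
    by_contra hne
    rw [not_nonempty_iff] at hne
    obtain ⟨m, -, hone, -⟩ := hY
    rw [show (1 : Y →ᵇ ℝ) = 0 from DFunLike.ext _ _ fun y => hne.elim y, map_zero] at hone
    exact zero_ne_one hone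
  obtain ⟨x, hx⟩ := (hA y).2
  refine Set.finite_univ_iff.1 ((Set.finite_iUnion fun z => (hA z).1).subset fun x' _ => ?_)
  obtain ⟨g, rfl⟩ := MulAction.exists_smul_eq H x x'
  exact Set.mem_iUnion.2 ⟨π g • y, hsmul g y x hx⟩

end Kazhdan

theorem mainTheorem5 {H Q : Type u}
    [Group H] [TopologicalSpace H] [IsTopologicalGroup H] [LocallyCompactSpace H] [T2Space H]
    [Group Q] [TopologicalSpace Q] [IsTopologicalGroup Q] [LocallyCompactSpace Q] [T2Space Q]
    (π : H →* Q) (hcont : Continuous π) (hdense : DenseRange π)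
    (hK : IsKazhdanHom π hdense) :
    (PropertyDFH H ↔ PropertyDFH Q) ∧
    (PropertyReducedDFH H ↔ PropertyReducedDFH Q) ∧
    (PropertyFM H ↔ PropertyFM Q) ∧
    (PropertyFM' H ↔ PropertyFM' Q) :=
  ⟨⟨PropertyDFH.of_denseRange hcont hdense, hK.propertyDFH_of_right⟩,
    ⟨hK.propertyReducedDFH_of_left hcont, hK.propertyReducedDFH_of_right hcont⟩,
    ⟨PropertyFM.of_denseRange hcont hdense, hK.propertyFM_of_right⟩,
    ⟨PropertyFM'.of_denseRange hcont hdense, hK.propertyFM'_of_right⟩⟩
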